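/- **Setting.** Let $d\in\{2,3\}$ and let $\Omega\subset\mathbb R^d$ be a simply connected bounded Lipschitz domain with $\partial\Omega=\overline\Gamma\cup\overline\Sigma$, where $\Gamma,\Sigma$ are disjoint, relatively open in $\partial\Omega$, of positive surface measure, and $\overline\Gamma\cap\overline\Sigma$ has surface measure zero. Put $r=6$, $s=6/5$, and $$\mathbf H_\star(\mathbf{curl}_s,\Omega)=\{\zeta\in \mathbf L^2:\ \mathbf{curl}\,\zeta\in \mathbf L^s,\ \text{zero tangential trace on }\Gamma\},$$ $$\mathbf H^r_\star(\mathrm{div},\Omega)=\{v\in \mathbf L^r:\ \mathrm{div}\,v\in L^2,\ v\cdot n=0\text{ on }\Gamma\},\qquad H^1_\star(\Omega)=\{S\in H^1(\Omega):\ S=0\text{ on }\Sigma\},$$ with norms $\|\zeta\|_{\mathbf{curl}_s}=\|\zeta\|_{0}+\|\mathbf{curl}\,\zeta\|_{L^s}$, $\|v\|_{r,\mathrm{div}}=\|v\|_{L^r}+\|\mathrm{div}\,v\|_{0}$, $\|S\|_1^2=\|S\|_0^2+\|\nabla S\|_0^2$, where $\|\cdot\|_0$ is the $L^2(\Omega)$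 norm. For $d=2$ the vorticity $\zeta$ is scalar and $\mathbf{curl}\,\zeta=(\partial_2\zeta,-\partial_1\zeta)$. Let $\rho,\mu,\mu',\kappa,c',\sigma_0,\alpha,\beta>0$, $T_0\in\mathbb R$, $\boldsymbol g\in \mathbf L^\infty(\Omega)$, $g\in L^2(\Omega)$, and $$a_1(\omega,\zeta)=\int_\Omega\omega\cdot\zeta,\quad b_1(\zeta,v)=-\sqrt{\mu'}\int_\Omega\mathbf{curl}\,\zeta\cdot v,\quad a_2(u,v)=\tfrac{\mu}{\kappa}\int_\Omega u\cdot v,\quad b_2(v,q)=\int_\Omega q\,\mathrm{div}\,v,$$ $$a_3(T,S)=\sigma_0\int_\Omega TS+\alpha\int_\Omega\nabla T\cdot\nabla S,\quad c_1(v;T,S)=\int_\Omega(v\cdot\nabla T)S,\quad c_2(u,v;S)=\tfrac{\mu}{\kappa c'\rho}\int_\Omega (u\cdot v)S,$$ $$F(S;v)=\rho\beta\int_\Omega(S-T_0)\,\boldsymbol g\cdot v,\qquad G(S)=\int_\Omega gS.$$ Let $Z_h\subset\mathbf H_\star(\mathbf{curl}_s,\Omega)$, $V_h\subset\mathbf H^r_\star(\mathrm{div},\Omega)$,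 $Q_h\subset L^2(\Omega)$, $Y_h\subset H^1_\star(\Omega)$ be finite-dimensional subspaces, and $V_{0,h}=\{v\in V_h: b_2(v,q)=0\ \forall q\in Q_h\}$. The Galerkin scheme is: find $(\omega_h,u_h,p_h,T_h)\in Z_h\times V_h\times Q_h\times Y_h$ with, for all $(\zeta,v,q,S)\in Z_h\times V_h\times Q_h\times Y_h$, $$a_1(\omega_h,\zeta)+b_1(\zeta,u_h)=0,\qquad b_1(\omega_h,v)-a_2(u_h,v)+b_2(v,p_h)=F(T_h;v),\qquad b_2(u_h,q)=0,$$ $$a_3(T_h,S)+c_1(u_h;T_h,S)-c_2(u_h,u_h;S)=G(S).$$ Let $\mathcal S_{1,h}(T)=(\omega_h,u_h)\in Z_h\times V_{0,h}$ be the solution of $a_1(\omega_h,\zeta)+b_1(\zeta,u_h)=0$ for all $\zeta\in Z_h$, $b_1(\omega_h,v)-a_2(u_h,v)=F(T;v)$ for all $v\in V_{0,h}$; let $\mathcal S_{12,h}(T)=u_h$; for $u\in V_{0,h}$ let $\mathcal S_{2,h}(u)=T\in Y_h$ be the solution of $a_3(T,S)+c_1(u;T,S)-c_2(u,u;S)=G(S)$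 for all $S\in Y_h$; and $\mathcal F_h=\mathcal S_{2,h}\circ\mathcal S_{12,h}:Y_h\to Y_h$. Assume, with $\hat\beta_1,\hat\beta_2>0$, * (A1) $\displaystyle\sup_{0\ne\zeta\in Z_h}\frac{b_1(\zeta,v)}{\|\zeta\|_{\mathbf{curl}_s}}\ge\hat\beta_1\|v\|_{r,\mathrm{div}}$ for all $v\in V_{0,h}$; * (A2) $\displaystyle\sup_{0\ne v\in V_h}\frac{b_2(v,q)}{\|v\|_{r,\mathrm{div}}}\ge\hat\beta_2\|q\|_{0}$ for all $q\in Q_h$; * (A3) $\mathrm{div}\,V_h\subseteq Q_h$. **Theorem.** There are constants $C_{s_1,d}>0$, depending only on $d$, $\hat\beta_1$ and $C_{\Omega,r}=|\Omega|^{(r-2)/(2r)}$, and $C_{s_2,d}>0$, depending only on $d$ and $\Omega$ (so both independent of the discrete spaces, of $h$ and of the data), such that the following holds. Write $B=\rho\beta\|\boldsymbol g\|_{\mathbf L^\infty(\Omega)}$, $m=\max\{\sigma_0^{-1},\alpha^{-1}\}$, $\|T_0\|_{0}=|T_0||\Omega|^{1/2}$. 1. $\mathcal S_{1,h}$ and $\mathcal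 S_{2,h}$ are well defined on $Y_h$ and $V_{0,h}$ (existence and uniqueness), with $\|\mathcal S_{12,h}(T)\|_{r,\mathrm{div}}\le C_{s_1,d}B(\|T\|_1+\|T_0\|_{0})$ and $\|\mathcal S_{2,h}(u)\|_1\le C_{s_2,d}\,m\,[\|g\|_{0}+\frac{\mu}{c'\rho\kappa}\|u\|_{r,\mathrm{div}}^2]$. For $T_h\in Y_h$ one has $\mathcal F_h(T_h)=T_h$ if and only if there is a unique triple $(\omega_h,u_h,p_h)$ such that $(\omega_h,u_h,p_h,T_h)$ solves the Galerkin scheme. 2. Let $$C_{1,d}=C_{s_2,d}\,m\Big[\|g\|_{0}+\tfrac{\mu}{c'\rho\kappa}\big(C_{s_1,d}B\|T_0\|_{0}\big)^2\Big],\qquad C_{2,d}=C_{s_1,d}^2C_{s_2,d}\,m\,B^2\tfrac{\mu}{c'\rho\kappa},$$ (so that $C_{1,d}=C_{s_2,d}\,m\,\|g\|_{0}$ when $T_0=0$) and suppose $C_{1,d}C_{2,d}<1/4$. Let $$x_{1,d}=\frac{1-\sqrt{1-4C_{1,d}C_{2,d}}}{2C_{2,d}},\qquad x_{2,d}=\frac{1+\sqrt{1-4C_{1,d}C_{2,d}}}{2C_{2,d}}$$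 (with $\boldsymbol g\neq 0$, so that $C_{2,d}>0$), and let $R_d>0$ satisfy $x_{1,d}\le R_d\le x_{2,d}$ and $$R_d\,C_{s_1,d}C_{s_2,d}\,B\,m\,(1+2C_{s_1,d}B)<1.$$ Then $\mathcal F_h$ has exactly one fixed point in $\{S\in Y_h:\|S\|_1\le R_d\}$, and the Galerkin scheme has exactly one solution $(\omega_h,u_h,p_h,T_h)$ with $\|T_h\|_1\le R_d$. -/

import Mathlib

open MeasureTheory Filter Topology
open scoped ENNReal NNReal

noncomputable section

namespace DarcyBrinkman

/-! ### Geometry -/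

/-- Points of `ℝᵈ`, with the Euclidean norm. -/
abbrev Pt (d : ℕ) := EuclideanSpace ℝ (Fin d)

/-- `Ω` is locally, in a suitable orthonormal frame, the strict hypograph of a Lipschitz function:
near `x` a point `y` is split as `⟪ν, y⟫ ν` plus its projection on the hyperplane `ν^⊥`. -/
def HasLipschitzBoundary {d : ℕ} (Ω : Set (Pt d)) : Prop :=
  ∀ x ∈ frontier Ω, ∃ (ν : Pt d) (r : ℝ) (K : ℝ≥0) (f : Pt d → ℝ),
    ‖ν‖ = 1 ∧ 0 < r ∧ LipschitzWith K f ∧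
      ∀ y ∈ Metric.ball x r, y ∈ Ω ↔ inner ℝ ν y < f (y - (inner ℝ ν y) • ν)

/-- A simply connected bounded Lipschitz domain, whose boundary is partitioned, up to a set of
surface measure zero, into the relatively open parts `Γ` and `Sig` of positive surface measure. -/
structure MixedDomain (d : ℕ) where
  Ω : Set (Pt d)
  Γ : Set (Pt d)
  Sig : Set (Pt d)
  isOpen : IsOpen Ω
  isBounded : Bornology.IsBounded Ω
  isSimplyConnected : IsSimplyConnected Ω
  lipschitz : HasLipschitzBoundary Ω
  Γ_open : ∃ U : Set (Pt d), IsOpen U ∧ Γ = frontier Ω ∩ U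
  Sig_open : ∃ U : Set (Pt d), IsOpen U ∧ Sig = frontier Ω ∩ U
  disjoint : Disjoint Γ Sig
  cover : frontier Ω = closure Γ ∪ closure Sig
  interface_null : μH[(d : ℝ) - 1] (closure Γ ∩ closure Sig) = 0
  Γ_pos : 0 < μH[(d : ℝ) - 1] Γ
  Sig_pos : 0 < μH[(d : ℝ) - 1] Sig

/-! ### The curl in two and three dimensions -/

/-- Number of components of a vorticity: `1` for `d = 2` and `3` for `d = 3`. -/
abbrev vortDim (d : ℕ) : ℕ := d * (d - 1) / 2

/-- The Levi-Civita symbol for indices in `{0, 1, 2}`. -/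
def leviCivita (i j k : ℕ) : ℝ :=
  (((j : ℝ) - i) * ((k : ℝ) - j) * ((k : ℝ) - i)) / 2

/-- Coefficients of the curl, `(curl ζ)ᵢ = ∑ⱼₐ curlCoeff d i j a * ∂ⱼ ζₐ`. For `d = 3` this is the
usual curl. For `d = 2` the vorticity is a scalar, seen as the third component of a vector field,
so that `curl ζ = (∂₂ ζ, - ∂₁ ζ)`. -/
def curlCoeff (d : ℕ) (i j : Fin d) (a : Fin (vortDim d)) : ℝ :=
  leviCivita i j ((a : ℕ) + (3 - vortDim d))

/-! ### Lebesgue and Sobolev spaces -/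

section Spaces

variable {d : ℕ}

/-- Lebesgue measure on `Ω`. -/
abbrev vol (D : MixedDomain d) : Measure (Pt d) := volume.restrict D.Ω

/-- The Lebesgue exponents `r = 6` and `s = 6/5`. -/
abbrev expR : ℝ≥0∞ := 6

/-- The conjugate exponent of `r = 6`. -/
abbrev expS : ℝ≥0∞ := 6 / 5

/-- Test functions in `C_c^∞(Ω)`. -/
def IsTest (D : MixedDomain d) (φ : Pt d → ℝ) : Prop :=
  ContDiff ℝ ((⊤ : ℕ∞) : WithTop ℕ∞) φ ∧ HasCompactSupport φ ∧ tsupport φ ⊆ D.Ω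

/-- `G = ∇ u` in the sense of distributions on `Ω`. -/
def HasWeakGrad (D : MixedDomain d) (u : Pt d → ℝ) (G : Pt d → Pt d) : Prop :=
  ∀ φ : Pt d → ℝ, IsTest D φ →
    ∫ x in D.Ω, u x • gradient φ x = - ∫ x in D.Ω, φ x • G x

/-- `q = div v` in the sense of distributions on `Ω`. -/
def HasWeakDiv (D : MixedDomain d) (v : Pt d → Pt d) (q : Pt d → ℝ) : Prop :=
  ∀ φ : Pt d → ℝ, IsTest D φ →
    ∫ x in D.Ω, inner ℝ (v x) (gradient φ x) = - ∫ x in D.Ω, q x * φ x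

/-- `w = curl ζ` in the sense of distributions on `Ω`. -/
def HasWeakCurl (D : MixedDomain d) (ζ : Pt d → EuclideanSpace ℝ (Fin (vortDim d)))
    (w : Pt d → Pt d) : Prop :=
  ∀ φ : Pt d → ℝ, IsTest D φ → ∀ i : Fin d,
    (∫ x in D.Ω, ∑ j : Fin d, ∑ a, curlCoeff d i j a * ζ x a * gradient φ x j)
      = - ∫ x in D.Ω, w x i * φ x

/-- A function `u ∈ W^{1,p}(Ω)` with gradient `G` has zero trace on `Sig`: it is the limit in
`W^{1,p}(Ω)` of restrictions of smooth functions whose boundary values tend to `0` in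
`L¹(Sig)`. (The trace is the continuous extension of the restriction to the boundary,
from `W^{1,p}(Ω)` to `L^p(∂Ω) ⊆ L¹(∂Ω)`, and such restrictions are dense in `W^{1,p}(Ω)`.) -/
def HasZeroTraceOnSig (D : MixedDomain d) (p : ℝ≥0∞) (u : Pt d → ℝ) (G : Pt d → Pt d) : Prop :=
  ∃ φ : ℕ → Pt d → ℝ,
    (∀ n, ContDiff ℝ ((⊤ : ℕ∞) : WithTop ℕ∞) (φ n) ∧ HasCompactSupport (φ n)) ∧
    Tendsto (fun n => eLpNorm (fun x => φ n x - u x) p (vol D)) atTop (𝓝 0) ∧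
    Tendsto (fun n => eLpNorm (fun x => gradient (φ n) x - G x) p (vol D)) atTop (𝓝 0) ∧
    Tendsto (fun n => ∫⁻ x in D.Sig, ‖φ n x‖ₑ ∂μH[(d : ℝ) - 1]) atTop (𝓝 0)

/-- Pairs `(ζ, curl ζ) ∈ L²(Ω) × L^s(Ω)`; a member of `H(curl_s, Ω)` is such a pair. -/
abbrev CurlPair (D : MixedDomain d) :=
  Lp (EuclideanSpace ℝ (Fin (vortDim d))) 2 (vol D) × Lp (Pt d) expS (vol D)

/-- Pairs `(v, div v) ∈ L^r(Ω) × L²(Ω)`; a member of `H^r(div, Ω)` is such a pair. -/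
abbrev DivPair (D : MixedDomain d) := Lp (Pt d) expR (vol D) × Lp ℝ 2 (vol D)

/-- Pairs `(S, ∇ S) ∈ L²(Ω) × L²(Ω)`; a member of `H¹(Ω)` is such a pair. -/
abbrev GradPair (D : MixedDomain d) := Lp ℝ 2 (vol D) × Lp (Pt d) 2 (vol D)

/-- The scalar space `L²(Ω)`. -/
abbrev L2 (D : MixedDomain d) := Lp ℝ 2 (vol D)

/-- `H_⋆(curl_s, Ω)`: the tangential trace, as a functional on the traces of `W^{1,s'}(Ω)`
(where `s' = r`), vanishes on all traces that are zero on `Sig`, hence supported in `Γ`. -/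
def HcurlStar (D : MixedDomain d) : Set (CurlPair D) :=
  {ζ | HasWeakCurl D ζ.1 ζ.2 ∧
    ∀ (w : Fin d → Lp ℝ expR (vol D)) (G : Fin d → Lp (Pt d) expR (vol D)),
      (∀ i, HasWeakGrad D (w i) (G i) ∧ HasZeroTraceOnSig D expR (w i) (G i)) →
      (∫ x in D.Ω, ∑ i, w i x * ζ.2 x i)
        + (∫ x in D.Ω, ∑ i, ∑ j, ∑ a, curlCoeff d i j a * G i x j * ζ.1 x a) = 0}

/-- `H^r_⋆(div, Ω)`: the normal trace, as a functional on the traces of `W^{1,r'}(Ω)`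
(where `r' = s`), vanishes on all traces that are zero on `Sig`, hence supported in `Γ`. -/
def HdivStar (D : MixedDomain d) : Set (DivPair D) :=
  {v | HasWeakDiv D v.1 v.2 ∧
    ∀ (q : Lp ℝ expS (vol D)) (G : Lp (Pt d) expS (vol D)),
      HasWeakGrad D q G → HasZeroTraceOnSig D expS q G →
      (∫ x in D.Ω, inner ℝ (v.1 x) (G x)) + (∫ x in D.Ω, v.2 x * q x) = 0}

/-- `H¹_⋆(Ω)`: functions in `H¹(Ω)` with zero trace on `Sig`. -/
def H1Star (D : MixedDomain d) : Set (GradPair D) :=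
  {S | HasWeakGrad D S.1 S.2 ∧ HasZeroTraceOnSig D 2 S.1 S.2}

/-- The norm of `H(curl_s, Ω)`. -/
def curlNorm {D : MixedDomain d} (ζ : CurlPair D) : ℝ := ‖ζ.1‖ + ‖ζ.2‖

/-- The norm of `H^r(div, Ω)`. -/
def divNorm {D : MixedDomain d} (v : DivPair D) : ℝ := ‖v.1‖ + ‖v.2‖

/-- The norm of `H¹(Ω)`. -/
def h1Norm {D : MixedDomain d} (S : GradPair D) : ℝ := √(‖S.1‖ ^ 2 + ‖S.2‖ ^ 2)

/-- `C_{Ω,r} = |Ω|^{(r-2)/(2r)}` with `r = 6`. -/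
def volConst (D : MixedDomain d) : ℝ := (volume.real D.Ω) ^ (((6 : ℝ) - 2) / (2 * 6))

/-! ### The model -/

/-- Physical coefficients, reference temperature, gravity and heat source. -/
structure Model (D : MixedDomain d) where
  rho : ℝ
  mu : ℝ
  muEff : ℝ
  kappa : ℝ
  heatCap : ℝ
  sigma0 : ℝ
  alpha : ℝ
  beta : ℝ
  refTemp : ℝ
  rho_pos : 0 < rho
  mu_pos : 0 < mu
  muEff_pos : 0 < muEff
  kappa_pos : 0 < kappa
  heatCap_pos : 0 < heatCap
  sigma0_pos : 0 < sigma0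
  alpha_pos : 0 < alpha
  beta_pos : 0 < beta
  gravity : Lp (Pt d) ⊤ (vol D)
  source : Lp ℝ 2 (vol D)

variable {D : MixedDomain d} (M : Model D)

def a1 (ω ζ : CurlPair D) : ℝ := ∫ x in D.Ω, inner ℝ (ω.1 x) (ζ.1 x)

def b1 (ζ : CurlPair D) (v : DivPair D) : ℝ :=
  - √M.muEff * ∫ x in D.Ω, inner ℝ (ζ.2 x) (v.1 x)

def a2 (u v : DivPair D) : ℝ := M.mu / M.kappa * ∫ x in D.Ω, inner ℝ (u.1 x) (v.1 x)

def b2 (v : DivPair D) (q : L2 D) : ℝ := ∫ x in D.Ω, q x * v.2 x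

def a3 (T S : GradPair D) : ℝ :=
  M.sigma0 * (∫ x in D.Ω, T.1 x * S.1 x)
    + M.alpha * (∫ x in D.Ω, inner ℝ (T.2 x) (S.2 x))

def c1 (v : DivPair D) (T S : GradPair D) : ℝ :=
  ∫ x in D.Ω, inner ℝ (v.1 x) (T.2 x) * S.1 x

def c2 (u v : DivPair D) (S : GradPair D) : ℝ :=
  M.mu / (M.kappa * M.heatCap * M.rho) * ∫ x in D.Ω, inner ℝ (u.1 x) (v.1 x) * S.1 x

def formF (S : GradPair D) (v : DivPair D) : ℝ :=
  M.rho * M.beta * ∫ x in D.Ω, (S.1 x - M.refTemp) * inner ℝ (M.gravity x) (v.1 x)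

def formG (S : GradPair D) : ℝ := ∫ x in D.Ω, M.source x * S.1 x

/-- `ρ β ‖g‖_∞`. -/
def buoyancy : ℝ := M.rho * M.beta * ‖M.gravity‖

/-- `max{σ₀⁻¹, α⁻¹}`. -/
def invCoer : ℝ := max M.sigma0⁻¹ M.alpha⁻¹

/-- The `L²(Ω)` norm of the constant reference temperature. -/
def refTempNorm : ℝ := |M.refTemp| * √(volume.real D.Ω)

/-! ### The Galerkin scheme -/

/-- Conforming finite-dimensional spaces for vorticity, velocity, pressure and temperature. -/
structure DiscreteSpaces (D : MixedDomain d) where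
  Z : Submodule ℝ (CurlPair D)
  V : Submodule ℝ (DivPair D)
  Q : Submodule ℝ (L2 D)
  Y : Submodule ℝ (GradPair D)
  Z_conf : ∀ ζ ∈ Z, ζ ∈ HcurlStar D
  V_conf : ∀ v ∈ V, v ∈ HdivStar D
  Y_conf : ∀ S ∈ Y, S ∈ H1Star D
  Z_fin : FiniteDimensional ℝ Z
  V_fin : FiniteDimensional ℝ V
  Q_fin : FiniteDimensional ℝ Q
  Y_fin : FiniteDimensional ℝ Y

variable (H : DiscreteSpaces D)

/-- The discrete kernel of `b₂`. -/
def kerV : Set (DivPair D) := {v | v ∈ H.V ∧ ∀ q ∈ H.Q, b2 v q = 0}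

/-- Discrete inf-sup condition for `b₁` on the discrete kernel of `b₂`. -/
def InfSupB1 (β₁ : ℝ) : Prop :=
  ∀ v ∈ kerV H, β₁ * divNorm v ≤ ⨆ ζ : {ζ : CurlPair D // ζ ∈ H.Z ∧ ζ ≠ 0},
    b1 M ζ.1 v / curlNorm ζ.1

/-- Discrete inf-sup condition for `b₂`. -/
def InfSupB2 (β₂ : ℝ) : Prop :=
  ∀ q ∈ H.Q, β₂ * ‖q‖ ≤ ⨆ v : {v : DivPair D // v ∈ H.V ∧ v ≠ 0}, b2 v.1 q / divNorm v.1

/-- `div V_h ⊆ Q_h`. -/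
def DivCompatible : Prop := ∀ v ∈ H.V, v.2 ∈ H.Q

/-- `(ω, u)` solves the reduced discrete Brinkman problem with temperature `T`. -/
def SolvesReduced (T : GradPair D) (w : CurlPair D × DivPair D) : Prop :=
  w.1 ∈ H.Z ∧ w.2 ∈ kerV H ∧
  (∀ ζ ∈ H.Z, a1 w.1 ζ + b1 M ζ w.2 = 0) ∧
  (∀ v ∈ kerV H, b1 M w.1 v - a2 M w.2 v = formF M T v)

/-- `T` solves the discrete thermal energy problem with velocity `u`. -/
def SolvesThermal (u : DivPair D) (T : GradPair D) : Prop :=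
  T ∈ H.Y ∧ ∀ S ∈ H.Y, a3 M T S + c1 u T S - c2 M u u S = formG M S

/-- `((ω, u, p), T)` solves the Galerkin scheme. -/
def SolvesGalerkin (X : CurlPair D × DivPair D × L2 D) (T : GradPair D) : Prop :=
  X.1 ∈ H.Z ∧ X.2.1 ∈ H.V ∧ X.2.2 ∈ H.Q ∧ T ∈ H.Y ∧
  (∀ ζ ∈ H.Z, a1 X.1 ζ + b1 M ζ X.2.1 = 0) ∧
  (∀ v ∈ H.V, b1 M X.1 v - a2 M X.2.1 v + b2 v X.2.2 = formF M T v) ∧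
  (∀ q ∈ H.Q, b2 X.2.1 q = 0) ∧
  (∀ S ∈ H.Y, a3 M T S + c1 X.2.1 T S - c2 M X.2.1 X.2.1 S = formG M S)

/-- `S_{1,h} = (S_{11,h}, S_{12,h})`: solution operator of the reduced problem. -/
def opS1 (T : GradPair D) : CurlPair D × DivPair D := Classical.epsilon (SolvesReduced M H T)

/-- `S_{2,h}`: solution operator of the thermal energy problem. -/
def opS2 (u : DivPair D) : GradPair D := Classical.epsilon (SolvesThermal M H u)

/-- The discrete fixed-point map `S_{2,h} ∘ S_{12,h}`. -/
def mapF (T : GradPair D) : GradPair D := opS2 M H (opS1 M H T).2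

/-! ### Data-dependent constants, for given stability constants `cs1`, `cs2` -/

/-- `C_{1,d}`; the second summand accounts for the reference temperature. -/
def const1 (cs1 cs2 : ℝ) : ℝ :=
  cs2 * invCoer M * (‖M.source‖
    + M.mu / (M.heatCap * M.rho * M.kappa) * (cs1 * buoyancy M * refTempNorm M) ^ 2)

/-- `C_{2,d}`. -/
def const2 (cs1 cs2 : ℝ) : ℝ :=
  cs1 ^ 2 * cs2 * invCoer M * buoyancy M ^ 2 * (M.mu / (M.heatCap * M.rho * M.kappa))

/-- `x_{1,d}`. -/
def root1 (cs1 cs2 : ℝ) : ℝ :=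
  (1 - √(1 - 4 * const1 M cs1 cs2 * const2 M cs1 cs2)) / (2 * const2 M cs1 cs2)

/-- `x_{2,d}`. -/
def root2 (cs1 cs2 : ℝ) : ℝ :=
  (1 + √(1 - 4 * const1 M cs1 cs2 * const2 M cs1 cs2)) / (2 * const2 M cs1 cs2)

end Spaces

end DarcyBrinkman

end

open DarcyBrinkman

/-!
The thermal problem is coercive because the convective form `c₁(u; S, S)` vanishes for a discretely
solenoidal velocity `u`, which `div V_h ⊆ Q_h` makes exactly solenoidal (`c1_self_eq_zero`). The
normal trace of `u` is only tested against functions whose trace on `Sig` vanishes in `L¹`, so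
`S² / 2`, whose trace would need an `L²` estimate on the boundary, is replaced by the functions
`k² (1 - cos (S / k))`, which are bounded by `k |S|`; then `k → ∞`.

Both this limit and the continuity of `c₁` use the embedding `H¹(Ω) ⊆ L³(Ω)` (`exists_sobolev`),
which is subcritical in dimension at most three. A bounded Lipschitz domain has locally uniform
interior cones; averaging `φ y = φ (y + w) - ∫₀¹ ∇φ (y + t w) · w dt` over the `w` in a ball bounds
`φ y` by averages of `φ` and `∇φ` over `y + t W`. For fixed `t` such an average maps `L²` to `L³`
with norm of order `t^{-d/6}`, which is integrable on `(0, 1)`. By definition, functions with zero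
trace on `Sig` are limits of smooth functions, so no extension or density theorem is needed.

The reduced Brinkman problem is a square linear system. The inf-sup condition for `b₁` bounds the
velocity by the vorticity, and testing with the solution bounds the vorticity
(`divNorm_le_of_reduced`); this gives `C₁ a b = a / b²`. The pressure is recovered from a functional
that vanishes on the kernel of `b₂` (`exists_pressure`), uniquely by the inf-sup condition for `b₂`.

In the ball of radius `R` the fixed-point map is Lipschitz with a constant
`C m C_{s₁} B (R + 2 (μ / (c' ρ κ)) C_{s₁} B (R + ‖T₀‖))`, where `C` (`thermalConst`) depends on `Ω`
only. The choice `C_{s₂} = 4 C` turns this into a quarter of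
`R C_{s₁} C_{s₂} B m + 2 C_{2,d} R + 2 C_{2,d} ‖T₀‖`, where the first term is less than one by
hypothesis, `C_{2,d} R ≤ 1` since `R` is at most the larger root, and `C_{2,d} ‖T₀‖ ≤ 1 / 2` since
`(C_{2,d} ‖T₀‖)² ≤ C_{1,d} C_{2,d}`. The map is therefore a contraction (`existsUnique_mapF`).
-/

open DarcyBrinkman

namespace DarcyBrinkman

/-! ### Interior cones and averages along them -/

/-- A Lipschitz domain has, near each point of its closure, a uniform interior cone, given here by
the segments from `0` to the points of a ball. At a boundary point the ball is
centred at a negative multiple of the outward direction `ν`. -/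
theorem exists_interior_cone {d : ℕ} {Ω : Set (Pt d)} (hΩ : IsOpen Ω)
    (hL : HasLipschitzBoundary Ω) {x : Pt d} (hx : x ∈ closure Ω) :
    ∃ ρ > 0, ∃ (c : Pt d), ∃ ε > 0, ∀ y ∈ Ω ∩ Metric.ball x ρ, ∀ w ∈ Metric.ball c ε,
      ∀ t ∈ Set.Icc (0 : ℝ) 1, y + t • w ∈ Ω := by
  by_cases hxΩ : x ∈ Ω
  · obtain ⟨δ, hδ, hball⟩ := Metric.isOpen_iff.1 hΩ x hxΩ
    refine ⟨δ / 2, by positivity, 0, δ / 2, by positivity, fun y hy w hw t ht => hball ?_⟩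
    have h1 : ‖y - x‖ < δ / 2 := by simpa [dist_eq_norm] using hy.2
    have h2 : ‖w‖ < δ / 2 := by simpa using hw
    have h3 : ‖t • w‖ ≤ ‖w‖ := by
      rw [norm_smul, Real.norm_of_nonneg ht.1]
      exact mul_le_of_le_one_left (norm_nonneg _) ht.2
    rw [Metric.mem_ball, dist_eq_norm]
    calc ‖y + t • w - x‖ = ‖(y - x) + t • w‖ := by congr 1; abel
      _ ≤ ‖y - x‖ + ‖t • w‖ := norm_add_le _ _
      _ < δ := by linarith
  · have hfr : x ∈ frontier Ω := by
      rw [hΩ.frontier_eq]; exact ⟨hx, hxΩ⟩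
    obtain ⟨ν, r, K, f, hν, hr, hf, hmem⟩ := hL x hfr
    set a : ℝ := r / 4 with ha
    have ha0 : 0 < a := by positivity
    set ε : ℝ := a / (1 + 2 * K) with hε
    have hK : (0 : ℝ) ≤ K := K.2
    have hε0 : 0 < ε := by positivity
    have hεa : ε * (1 + 2 * K) = a := by rw [hε]; field_simp
    have hεa' : ε ≤ a := by nlinarith
    refine ⟨r / 2, by positivity, -(a • ν), ε, hε0, fun y hy w hw t ht => ?_⟩
    obtain ⟨e, rfl⟩ : ∃ e, w = -(a • ν) + e := ⟨w + a • ν, by abel⟩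
    have he : ‖e‖ < ε := by simpa [dist_eq_norm] using hw
    have h1 : ‖y - x‖ < r / 2 := by simpa [dist_eq_norm] using hy.2
    have hw2 : ‖t • (-(a • ν) + e)‖ ≤ r / 2 := by
      rw [norm_smul, Real.norm_of_nonneg ht.1]
      have : ‖-(a • ν) + e‖ ≤ a + ε := by
        refine (norm_add_le _ _).trans ?_
        rw [norm_neg, norm_smul, hν, Real.norm_of_nonneg ha0.le]; linarith
      calc t * ‖-(a • ν) + e‖ ≤ 1 * (a + ε) := by
            gcongr
            exact ht.2
        _ ≤ r / 2 := by linarith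
    have hyx : y ∈ Metric.ball x r := by
      rw [Metric.mem_ball, dist_eq_norm]; linarith
    have hzx : y + t • (-(a • ν) + e) ∈ Metric.ball x r := by
      rw [Metric.mem_ball, dist_eq_norm]
      calc ‖y + t • (-(a • ν) + e) - x‖ = ‖(y - x) + t • (-(a • ν) + e)‖ := by congr 1; abel
        _ ≤ ‖y - x‖ + ‖t • (-(a • ν) + e)‖ := norm_add_le _ _
        _ < r := by linarith
    rw [hmem _ hzx]
    have hy' := (hmem _ hyx).1 hy.1
    have hνν : inner ℝ ν ν = 1 := by rw [real_inner_self_eq_norm_sq, hν]; norm_num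
    have hin : inner ℝ ν (y + t • (-(a • ν) + e)) = inner ℝ ν y + t * (-a + inner ℝ ν e) := by
      simp only [inner_add_right, inner_smul_right, inner_neg_right, hνν]; ring
    have hνe : |inner ℝ ν e| ≤ ‖e‖ := by
      have := abs_real_inner_le_norm ν e
      rwa [hν, one_mul] at this
    have hproj : (y + t • (-(a • ν) + e)) - (inner ℝ ν (y + t • (-(a • ν) + e))) • ν
        = (y - (inner ℝ ν y) • ν) + t • (e - (inner ℝ ν e) • ν) := by
      rw [hin]; module
    have hlip : f (y - (inner ℝ ν y) • ν)
        ≤ f (y + t • (-(a • ν) + e) - (inner ℝ ν (y + t • (-(a • ν) + e))) • ν)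
          + K * (t * (2 * ‖e‖)) := by
      have h := hf.dist_le_mul (y - (inner ℝ ν y) • ν)
        (y + t • (-(a • ν) + e) - (inner ℝ ν (y + t • (-(a • ν) + e))) • ν)
      rw [hproj, dist_self_add_right, Real.dist_eq, norm_smul, Real.norm_of_nonneg ht.1] at h
      have h2 : ‖e - (inner ℝ ν e) • ν‖ ≤ 2 * ‖e‖ := by
        refine (norm_sub_le _ _).trans ?_
        rw [norm_smul, hν, Real.norm_eq_abs]; linarith
      have h3 : (K : ℝ) * (t * ‖e - (inner ℝ ν e) • ν‖) ≤ K * (t * (2 * ‖e‖)) := by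
        have := ht.1
        gcongr
      have h4 := (le_abs_self _).trans (h.trans h3)
      rw [hproj]; linarith
    have h5 : t * (-a + inner ℝ ν e) + K * (t * (2 * ‖e‖)) ≤ 0 := by
      have h6 : -a + inner ℝ ν e + K * (2 * ‖e‖) ≤ 0 := by
        have := (abs_le.1 hνe).2
        nlinarith
      have := mul_nonpos_of_nonneg_of_nonpos ht.1 h6
      linarith
    have h7 : inner ℝ ν (y + t • (-(a • ν) + e)) + K * (t * (2 * ‖e‖)) ≤ inner ℝ ν y := by
      rw [hin]; linarith
    linarith

section Averages
variable {d : ℕ}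

theorem lintegral_comp_add_smul (g : Pt d → ℝ≥0∞) (y : Pt d) {t : ℝ} (ht : 0 < t) :
    ∫⁻ w, g (y + t • w) = ENNReal.ofReal ((t ^ d)⁻¹) * ∫⁻ z, g z := by
  have h1 : ∫⁻ w, g (y + t • w) = ∫⁻ z, g (y + z) ∂(Measure.map (t • ·) volume) := by
    have := (MeasurableEquiv.smul₀ (α := Pt d) t ht.ne').measurableEmbedding.lintegral_map
      (μ := volume) (fun z => g (y + z))
    exact this.symm
  rw [h1, Measure.map_addHaar_smul _ ht.ne', lintegral_smul_measure, lintegral_add_left_eq_self]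
  simp [abs_of_pos (pow_pos ht d)]

theorem sq_setLIntegral_le {α : Type*} [MeasurableSpace α] {μ : Measure α} (W : Set α)
    {f : α → ℝ≥0∞} (hf : Measurable f) :
    (∫⁻ w in W, f w ∂μ) ^ 2 ≤ μ W * ∫⁻ w in W, f w ^ 2 ∂μ := by
  have h := ENNReal.lintegral_mul_le_Lp_mul_Lq (μ.restrict W) Real.HolderConjugate.two_two
    (f := fun _ => 1) (g := f) aemeasurable_const hf.aemeasurable
  simp only [Pi.mul_apply, one_mul, ENNReal.one_rpow, lintegral_const, Measure.restrict_apply,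
    MeasurableSet.univ, Set.univ_inter] at h
  calc (∫⁻ w in W, f w ∂μ) ^ 2
      ≤ (μ W ^ (1 / (2:ℝ)) * (∫⁻ w in W, f w ^ (2:ℝ) ∂μ) ^ (1 / (2:ℝ))) ^ 2 := by gcongr
    _ = _ := by
      rw [mul_pow, ← ENNReal.rpow_natCast, ← ENNReal.rpow_natCast, ← ENNReal.rpow_mul,
        ← ENNReal.rpow_mul]
      norm_num

/-- The `L³` bound for the average of `g` over `y + t W`, which combines the `L²` bound with the
`L^∞` bound obtained from the change of variables `w ↦ y + t w`. -/
theorem lintegral_cube_average_le {W : Set (Pt d)} {g : Pt d → ℝ≥0∞}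
    (hg : Measurable g) {t : ℝ} (ht : 0 < t) :
    ∫⁻ y, (∫⁻ w in W, g (y + t • w)) ^ 3 ≤
      volume W ^ (5 / 2 : ℝ) * ENNReal.ofReal (t ^ (-(d : ℝ) / 2)) *
        (∫⁻ z, g z ^ 2) ^ (3 / 2 : ℝ) := by
  set A : ℝ≥0∞ := ∫⁻ z, g z ^ 2
  set N : Pt d → ℝ≥0∞ := fun y => ∫⁻ w in W, g (y + t • w) ^ 2 with hN
  have hNm : Measurable N := by
    refine Measurable.lintegral_prod_right' (f := fun p : Pt d × Pt d => g (p.1 + t • p.2) ^ 2) ?_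
    fun_prop
  have hsq : ∀ y, (∫⁻ w in W, g (y + t • w)) ^ 2 ≤ volume W * N y := fun y =>
    sq_setLIntegral_le W (by fun_prop)
  have hNle : ∀ y, N y ≤ ENNReal.ofReal ((t ^ d)⁻¹) * A := fun y => by
    calc N y ≤ ∫⁻ w, g (y + t • w) ^ 2 := setLIntegral_le_lintegral _ _
      _ = _ := lintegral_comp_add_smul (fun z => g z ^ 2) y ht
  have hNint : ∫⁻ y, N y = volume W * A := by
    simp only [hN]
    rw [lintegral_lintegral_swap (by fun_prop)]
    simp_rw [lintegral_add_right_eq_self (fun z => g z ^ 2)]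
    simp [A, mul_comm]
  have hone : ∀ y, (∫⁻ w in W, g (y + t • w)) ≤
      volume W ^ (1 / 2 : ℝ) * ENNReal.ofReal (t ^ (-(d : ℝ) / 2)) * A ^ (1 / 2 : ℝ) := fun y => by
    have h := (hsq y).trans (mul_le_mul_right (hNle y) (volume W))
    have h2 := ENNReal.rpow_le_rpow h (by norm_num : (0:ℝ) ≤ 1 / 2)
    rw [← ENNReal.rpow_natCast, ← ENNReal.rpow_mul] at h2
    norm_num at h2
    refine h2.trans (le_of_eq ?_)
    rw [ENNReal.mul_rpow_of_nonneg _ _ (by norm_num), ENNReal.mul_rpow_of_nonneg _ _ (by norm_num),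
      ENNReal.ofReal_rpow_of_nonneg (by positivity) (by norm_num), ← mul_assoc]
    congr 3
    rw [← Real.rpow_natCast, ← Real.rpow_neg ht.le, ← Real.rpow_mul ht.le]
    ring_nf
  calc ∫⁻ y, (∫⁻ w in W, g (y + t • w)) ^ 3
      ≤ ∫⁻ y, (volume W ^ (1 / 2 : ℝ) * ENNReal.ofReal (t ^ (-(d : ℝ) / 2)) * A ^ (1 / 2 : ℝ))
          * (volume W * N y) := by
        refine lintegral_mono fun y => ?_
        rw [pow_succ']
        exact mul_le_mul' (hone y) (hsq y)
    _ = volume W ^ (1 / 2 : ℝ) * ENNReal.ofReal (t ^ (-(d : ℝ) / 2)) * A ^ (1 / 2 : ℝ)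
          * (volume W * (volume W * A)) := by
        rw [lintegral_const_mul _ (by fun_prop), lintegral_const_mul _ hNm, hNint]
    _ = (volume W ^ (1 / 2 : ℝ) * volume W ^ (1 : ℝ) * volume W ^ (1 : ℝ)) *
          ENNReal.ofReal (t ^ (-(d : ℝ) / 2)) * (A ^ (1 / 2 : ℝ) * A ^ (1 : ℝ)) := by
        simp only [ENNReal.rpow_one]; ring
    _ = _ := by
        rw [← ENNReal.rpow_add_of_nonneg, ← ENNReal.rpow_add_of_nonneg,
          ← ENNReal.rpow_add_of_nonneg] <;> norm_num

/-- Hölder's inequality in `t` with the weight `t^{1/3}`, whose inverse is integrable to the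
power `3/2`. -/
theorem cube_setLIntegral_Ioc_le {h : ℝ → ℝ≥0∞} (hm : Measurable h) :
    (∫⁻ t in Set.Ioc (0 : ℝ) 1, h t) ^ 3 ≤
      (∫⁻ t in Set.Ioc (0 : ℝ) 1, ENNReal.ofReal (t ^ (-(1 / 2) : ℝ))) ^ 2 *
        ∫⁻ t in Set.Ioc (0 : ℝ) 1, ENNReal.ofReal t * h t ^ 3 := by
  have hpq : Real.HolderConjugate (3 / 2) 3 := by
    rw [Real.holderConjugate_iff]; norm_num
  have hH := ENNReal.lintegral_mul_le_Lp_mul_Lq (volume.restrict (Set.Ioc (0 : ℝ) 1)) hpq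
    (f := fun t => ENNReal.ofReal (t ^ (-(1 / 3) : ℝ)))
    (g := fun t => ENNReal.ofReal (t ^ (1 / 3 : ℝ)) * h t) (by fun_prop) (by fun_prop)
  have e1 : ∫⁻ t in Set.Ioc (0 : ℝ) 1, ((fun t : ℝ => ENNReal.ofReal (t ^ (-(1 / 3) : ℝ))) *
      (fun t => ENNReal.ofReal (t ^ (1 / 3 : ℝ)) * h t)) t = ∫⁻ t in Set.Ioc (0 : ℝ) 1, h t := by
    refine setLIntegral_congr_fun measurableSet_Ioc fun t ht => ?_
    simp only [Pi.mul_apply]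
    rw [← mul_assoc, ← ENNReal.ofReal_mul (Real.rpow_nonneg ht.1.le _), ← Real.rpow_add ht.1]
    norm_num
  have e2 : ∫⁻ t in Set.Ioc (0 : ℝ) 1, ENNReal.ofReal (t ^ (-(1 / 3) : ℝ)) ^ (3 / 2 : ℝ)
      = ∫⁻ t in Set.Ioc (0 : ℝ) 1, ENNReal.ofReal (t ^ (-(1 / 2) : ℝ)) := by
    refine setLIntegral_congr_fun measurableSet_Ioc fun t ht => ?_
    rw [ENNReal.ofReal_rpow_of_nonneg (Real.rpow_nonneg ht.1.le _) (by norm_num),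
      ← Real.rpow_mul ht.1.le]
    norm_num
  have e3 : ∫⁻ t in Set.Ioc (0 : ℝ) 1, (ENNReal.ofReal (t ^ (1 / 3 : ℝ)) * h t) ^ (3 : ℝ)
      = ∫⁻ t in Set.Ioc (0 : ℝ) 1, ENNReal.ofReal t * h t ^ 3 := by
    refine setLIntegral_congr_fun measurableSet_Ioc fun t ht => ?_
    rw [ENNReal.mul_rpow_of_nonneg _ _ (by norm_num),
      ENNReal.ofReal_rpow_of_nonneg (Real.rpow_nonneg ht.1.le _) (by norm_num),
      ← Real.rpow_mul ht.1.le, ← ENNReal.rpow_natCast]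
    norm_num
  rw [e1, e2, e3] at hH
  calc (∫⁻ t in Set.Ioc (0 : ℝ) 1, h t) ^ 3 ≤ _ := pow_le_pow_left' hH 3
    _ = _ := by
      rw [mul_pow]
      congr 1
      · rw [← ENNReal.rpow_natCast, ← ENNReal.rpow_mul, ← ENNReal.rpow_natCast]; norm_num
      · rw [← ENNReal.rpow_natCast, ← ENNReal.rpow_mul]; norm_num

theorem setLIntegral_rpow_neg_half_lt_top :
    ∫⁻ t in Set.Ioc (0 : ℝ) 1, ENNReal.ofReal (t ^ (-(1 / 2) : ℝ)) < ∞ := by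
  have h : IntervalIntegrable (fun t : ℝ => t ^ (-(1 / 2) : ℝ)) volume 0 1 :=
    intervalIntegral.intervalIntegrable_rpow' (by norm_num)
  rw [intervalIntegrable_iff_integrableOn_Ioc_of_le zero_le_one] at h
  exact h.lintegral_lt_top

/-- The operator `g ↦ ∫_W ∫_0^1 g (y + t w) dt dw` maps `L²` to `L³` in dimension at most three. -/
theorem lintegral_cube_cone_average_le (hd : d ≤ 3) {W : Set (Pt d)} {g : Pt d → ℝ≥0∞}
    (hg : Measurable g) :
    ∫⁻ y, (∫⁻ w in W, ∫⁻ t in Set.Ioc (0 : ℝ) 1, g (y + t • w)) ^ 3 ≤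
      (∫⁻ t in Set.Ioc (0 : ℝ) 1, ENNReal.ofReal (t ^ (-(1 / 2) : ℝ))) ^ 3 *
        volume W ^ (5 / 2 : ℝ) * (∫⁻ z, g z ^ 2) ^ (3 / 2 : ℝ) := by
  set I := ∫⁻ t in Set.Ioc (0 : ℝ) 1, ENNReal.ofReal (t ^ (-(1 / 2) : ℝ))
  have hm : Measurable fun p : Pt d × ℝ => ∫⁻ w in W, g (p.1 + p.2 • w) := by
    refine Measurable.lintegral_prod_right'
      (f := fun q : (Pt d × ℝ) × Pt d => g (q.1.1 + q.1.2 • q.2)) ?_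
    fun_prop
  calc ∫⁻ y, (∫⁻ w in W, ∫⁻ t in Set.Ioc (0 : ℝ) 1, g (y + t • w)) ^ 3
      = ∫⁻ y, (∫⁻ t in Set.Ioc (0 : ℝ) 1, ∫⁻ w in W, g (y + t • w)) ^ 3 := by
        refine lintegral_congr fun y => ?_
        rw [lintegral_lintegral_swap (by fun_prop)]
    _ ≤ ∫⁻ y, I ^ 2 * ∫⁻ t in Set.Ioc (0 : ℝ) 1,
          ENNReal.ofReal t * (∫⁻ w in W, g (y + t • w)) ^ 3 :=
        lintegral_mono fun y => cube_setLIntegral_Ioc_le (hm.comp measurable_prodMk_left)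
    _ = I ^ 2 * ∫⁻ t in Set.Ioc (0 : ℝ) 1,
          ENNReal.ofReal t * ∫⁻ y, (∫⁻ w in W, g (y + t • w)) ^ 3 := by
        have hm2 : Measurable fun p : Pt d × ℝ =>
            ENNReal.ofReal p.2 * (∫⁻ w in W, g (p.1 + p.2 • w)) ^ 3 := by fun_prop
        rw [lintegral_const_mul _ hm2.lintegral_prod_right',
          lintegral_lintegral_swap hm2.aemeasurable]
        congr 1
        refine lintegral_congr fun t => ?_
        have hmt : Measurable fun y => ∫⁻ w in W, g (y + t • w) := hm.comp measurable_prodMk_right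
        exact lintegral_const_mul (ENNReal.ofReal t) (hmt.pow_const 3)
    _ ≤ I ^ 2 * ∫⁻ t in Set.Ioc (0 : ℝ) 1, ENNReal.ofReal (t ^ (-(1 / 2) : ℝ)) *
          (volume W ^ (5 / 2 : ℝ) * (∫⁻ z, g z ^ 2) ^ (3 / 2 : ℝ)) := by
        refine mul_le_mul_right (setLIntegral_mono' measurableSet_Ioc fun t ht => ?_) _
        refine (mul_le_mul_right (lintegral_cube_average_le hg ht.1) _).trans ?_
        have h1 : ENNReal.ofReal t * ENNReal.ofReal (t ^ (-(d : ℝ) / 2)) ≤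
            ENNReal.ofReal (t ^ (-(1 / 2) : ℝ)) := by
          rw [← ENNReal.ofReal_mul ht.1.le]
          refine ENNReal.ofReal_le_ofReal ?_
          nth_rw 1 [← Real.rpow_one t]
          rw [← Real.rpow_add ht.1]
          refine Real.rpow_le_rpow_of_exponent_ge ht.1 ht.2 ?_
          have : (d : ℝ) ≤ 3 := by exact_mod_cast hd
          linarith
        calc _ = (ENNReal.ofReal t * ENNReal.ofReal (t ^ (-(d : ℝ) / 2))) *
              (volume W ^ (5 / 2 : ℝ) * (∫⁻ z, g z ^ 2) ^ (3 / 2 : ℝ)) := by ring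
          _ ≤ _ := by gcongr
    _ = _ := by
        rw [lintegral_mul_const _ (by fun_prop)]
        ring

end Averages

/-! ### The Sobolev embedding in `L³` -/

section Sobolev
variable {d : ℕ}

theorem enorm_gradient (φ : Pt d → ℝ) (x : Pt d) : ‖gradient φ x‖ₑ = ‖fderiv ℝ φ x‖ₑ := by
  rw [gradient, enorm_eq_iff_norm_eq, LinearIsometryEquiv.norm_map]

theorem continuous_gradient {φ : Pt d → ℝ} (hφ : ContDiff ℝ 1 φ) :
    Continuous (gradient φ) :=
  (InnerProductSpace.toDual ℝ (Pt d)).symm.continuous.comp (hφ.continuous_fderiv one_ne_zero)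

theorem enorm_le_add_lintegral_gradient {φ : Pt d → ℝ} (hφ : ContDiff ℝ 1 φ) (y w : Pt d) :
    ‖φ y‖ₑ ≤ ‖φ (y + w)‖ₑ +
      ‖w‖ₑ * ∫⁻ t in Set.Ioc (0 : ℝ) 1, ‖gradient φ (y + t • w)‖ₑ := by
  have hline : ∀ t : ℝ, HasDerivAt (fun t : ℝ => φ (y + t • w)) (fderiv ℝ φ (y + t • w) w) t := by
    intro t
    have h1 : HasDerivAt (fun t : ℝ => y + t • w) w t := by
      simpa using ((hasDerivAt_id t).smul_const w).const_add y
    exact ((hφ.differentiable one_ne_zero).differentiableAt.hasFDerivAt).comp_hasDerivAt t h1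
  have hcd : ContDiff ℝ 1 (fun t : ℝ => φ (y + t • w)) := hφ.comp (by fun_prop)
  have h := enorm_sub_le_lintegral_deriv_of_contDiffOn_Icc (hcd.contDiffOn (s := Set.Icc 0 1))
    zero_le_one
  simp only [one_smul, zero_smul, add_zero] at h
  have h2 : ∫⁻ t in Set.Icc (0 : ℝ) 1, ‖deriv (fun t : ℝ => φ (y + t • w)) t‖ₑ ≤
      ‖w‖ₑ * ∫⁻ t in Set.Ioc (0 : ℝ) 1, ‖gradient φ (y + t • w)‖ₑ := by
    rw [restrict_Ioc_eq_restrict_Icc, ← lintegral_const_mul']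
    · refine lintegral_mono fun t => ?_
      rw [(hline t).deriv, enorm_gradient, mul_comm]
      exact ContinuousLinearMap.le_opENorm _ _
    · exact enorm_ne_top
  calc ‖φ y‖ₑ = ‖φ (y + w) - (φ (y + w) - φ y)‖ₑ := by congr 1; ring
    _ ≤ ‖φ (y + w)‖ₑ + ‖φ (y + w) - φ y‖ₑ := enorm_sub_le
    _ ≤ _ := by gcongr; exact h.trans h2

/-- The Sobolev estimate on a piece `A` of `Ω` that admits a common interior cone. -/
theorem exists_local_sobolev (hd : d ≤ 3) {Ω A : Set (Pt d)} (hΩ : MeasurableSet Ω)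
    (hA : MeasurableSet A) {c : Pt d} {ε : ℝ} (hε : 0 < ε)
    (hcone : ∀ y ∈ A, ∀ w ∈ Metric.ball c ε, ∀ t ∈ Set.Icc (0 : ℝ) 1, y + t • w ∈ Ω) :
    ∃ C : ℝ≥0∞, C ≠ ∞ ∧ ∀ φ : Pt d → ℝ, ContDiff ℝ 1 φ →
      ∫⁻ y in A, ‖φ y‖ₑ ^ 3 ≤ C * ((∫⁻ y in Ω, ‖φ y‖ₑ ^ 2) ^ (3 / 2 : ℝ) +
        (∫⁻ y in Ω, ‖gradient φ y‖ₑ ^ 2) ^ (3 / 2 : ℝ)) := by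
  set W := Metric.ball c ε with hW
  have hW0 : volume W ≠ 0 := (Metric.measure_ball_pos volume c hε).ne'
  have hWt : volume W ≠ ∞ := measure_ball_lt_top.ne
  set I := ∫⁻ t in Set.Ioc (0 : ℝ) 1, ENNReal.ofReal (t ^ (-(1 / 2) : ℝ)) with hI
  have hIt : I ≠ ∞ := setLIntegral_rpow_neg_half_lt_top.ne
  set N := ENNReal.ofReal (‖c‖ + ε) with hN
  set K := 4 * (volume W ^ (5 / 2 : ℝ) * (1 + N ^ 3 * I ^ 3)) with hK
  have hKt : K ≠ ∞ := by
    have : volume W ^ (5 / 2 : ℝ) ≠ ∞ := ENNReal.rpow_ne_top_of_nonneg (by norm_num) hWt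
    finiteness
  refine ⟨(volume W ^ 3)⁻¹ * K, ENNReal.mul_ne_top (by simp [hW0]) hKt, fun φ hφ => ?_⟩
  set g₀ : Pt d → ℝ≥0∞ := Ω.indicator fun y => ‖φ y‖ₑ with hg₀
  set g₁ : Pt d → ℝ≥0∞ := Ω.indicator fun y => ‖gradient φ y‖ₑ with hg₁
  have hm₀ : Measurable g₀ := hφ.continuous.measurable.enorm.indicator hΩ
  have hm₁ : Measurable g₁ := (continuous_gradient hφ).measurable.enorm.indicator hΩ
  have hint₀ : ∫⁻ z, g₀ z ^ 2 = ∫⁻ y in Ω, ‖φ y‖ₑ ^ 2 := by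
    rw [← lintegral_indicator hΩ]
    congr 1 with z
    by_cases hz : z ∈ Ω <;> simp [g₀, hz]
  have hint₁ : ∫⁻ z, g₁ z ^ 2 = ∫⁻ y in Ω, ‖gradient φ y‖ₑ ^ 2 := by
    rw [← lintegral_indicator hΩ]
    congr 1 with z
    by_cases hz : z ∈ Ω <;> simp [g₁, hz]
  set u : Pt d → ℝ≥0∞ := fun y => ∫⁻ w in W, g₀ (y + (1 : ℝ) • w)
  set v : Pt d → ℝ≥0∞ := fun y => ∫⁻ w in W, ∫⁻ t in Set.Ioc (0 : ℝ) 1, g₁ (y + t • w)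
  have hum : Measurable u := by
    refine Measurable.lintegral_prod_right' (f := fun p : Pt d × Pt d => g₀ (p.1 + (1:ℝ) • p.2)) ?_
    fun_prop
  have hpt : ∀ y ∈ A, volume W * ‖φ y‖ₑ ≤ u y + N * v y := by
    intro y hy
    have h1 : ∀ w ∈ W, ‖φ y‖ₑ ≤ g₀ (y + (1 : ℝ) • w) +
        N * ∫⁻ t in Set.Ioc (0 : ℝ) 1, g₁ (y + t • w) := by
      intro w hw
      refine (enorm_le_add_lintegral_gradient hφ y w).trans ?_
      have hmem : y + (1 : ℝ) • w ∈ Ω := hcone y hy w hw 1 (by simp)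
      gcongr ?_ + ?_ * ?_
      · rw [hg₀, Set.indicator_of_mem hmem, one_smul]
      · rw [hN, ← ofReal_norm]
        refine ENNReal.ofReal_le_ofReal ?_
        have : ‖w - c‖ < ε := by simpa [hW, dist_eq_norm] using hw
        calc ‖w‖ = ‖c + (w - c)‖ := by congr 1; abel
          _ ≤ ‖c‖ + ‖w - c‖ := norm_add_le _ _
          _ ≤ _ := by linarith
      · refine setLIntegral_mono' measurableSet_Ioc fun t ht => ?_
        have hmem : y + t • w ∈ Ω := hcone y hy w hw t ⟨ht.1.le, ht.2⟩
        rw [hg₁, Set.indicator_of_mem hmem]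
    calc volume W * ‖φ y‖ₑ = ∫⁻ _ in W, ‖φ y‖ₑ := by rw [setLIntegral_const, mul_comm]
      _ ≤ ∫⁻ w in W, (g₀ (y + (1 : ℝ) • w) + N * ∫⁻ t in Set.Ioc (0 : ℝ) 1, g₁ (y + t • w)) :=
        setLIntegral_mono' Metric.isOpen_ball.measurableSet h1
      _ = u y + N * v y := by
        rw [lintegral_add_left (by fun_prop), lintegral_const_mul' _ _ (by finiteness)]
  have hcube : ∀ y ∈ A, volume W ^ 3 * ‖φ y‖ₑ ^ 3 ≤ 4 * (u y ^ 3 + N ^ 3 * v y ^ 3) := by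
    intro y hy
    rw [← mul_pow, ← mul_pow]
    refine (pow_le_pow_left' (hpt y hy) 3).trans ?_
    have h := ENNReal.rpow_add_le_mul_rpow_add_rpow (u y) (N * v y) (p := 3) (by norm_num)
    have e : (2 : ℝ≥0∞) ^ ((3 : ℝ) - 1) = 4 := by
      rw [show (3 : ℝ) - 1 = ((2 : ℕ) : ℝ) by norm_num, ENNReal.rpow_natCast]; norm_num
    rw [e] at h
    exact_mod_cast h
  have hu3 : ∫⁻ y, u y ^ 3 ≤ volume W ^ (5 / 2 : ℝ) *
      (∫⁻ y in Ω, ‖φ y‖ₑ ^ 2) ^ (3 / 2 : ℝ) := by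
    have := lintegral_cube_average_le (W := W) hm₀ one_pos
    simpa only [hint₀, Real.one_rpow, ENNReal.ofReal_one, mul_one] using this
  have hv3 : ∫⁻ y, v y ^ 3 ≤ I ^ 3 * volume W ^ (5 / 2 : ℝ) *
      (∫⁻ y in Ω, ‖gradient φ y‖ₑ ^ 2) ^ (3 / 2 : ℝ) := by
    have := lintegral_cube_cone_average_le hd (W := W) hm₁
    rwa [hint₁] at this
  set a := (∫⁻ y in Ω, ‖φ y‖ₑ ^ 2) ^ (3 / 2 : ℝ)
  set b := (∫⁻ y in Ω, ‖gradient φ y‖ₑ ^ 2) ^ (3 / 2 : ℝ)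
  have hmain : volume W ^ 3 * ∫⁻ y in A, ‖φ y‖ₑ ^ 3 ≤ K * (a + b) := by
    calc volume W ^ 3 * ∫⁻ y in A, ‖φ y‖ₑ ^ 3
        = ∫⁻ y in A, volume W ^ 3 * ‖φ y‖ₑ ^ 3 :=
          (lintegral_const_mul' _ _ (by finiteness)).symm
      _ ≤ ∫⁻ y in A, 4 * (u y ^ 3 + N ^ 3 * v y ^ 3) := setLIntegral_mono' hA hcube
      _ ≤ ∫⁻ y, 4 * (u y ^ 3 + N ^ 3 * v y ^ 3) := setLIntegral_le_lintegral _ _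
      _ = 4 * ((∫⁻ y, u y ^ 3) + N ^ 3 * ∫⁻ y, v y ^ 3) := by
        rw [lintegral_const_mul' _ _ (by finiteness), lintegral_add_left (hum.pow_const 3),
          lintegral_const_mul' _ _ (by finiteness)]
      _ ≤ 4 * (volume W ^ (5 / 2 : ℝ) * a + N ^ 3 * (I ^ 3 * volume W ^ (5 / 2 : ℝ) * b)) := by
        gcongr
      _ = 4 * (volume W ^ (5 / 2 : ℝ) * (1 * a + N ^ 3 * I ^ 3 * b)) := by ring
      _ ≤ 4 * (volume W ^ (5 / 2 : ℝ) * ((1 + N ^ 3 * I ^ 3) * a + (1 + N ^ 3 * I ^ 3) * b)) := by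
        gcongr
        · exact le_self_add
        · exact le_add_self
      _ = K * (a + b) := by rw [hK]; ring
  have hW3 : volume W ^ 3 ≠ 0 := pow_ne_zero _ hW0
  have hW3t : volume W ^ 3 ≠ ∞ := by finiteness
  calc ∫⁻ y in A, ‖φ y‖ₑ ^ 3
      = (volume W ^ 3)⁻¹ * (volume W ^ 3 * ∫⁻ y in A, ‖φ y‖ₑ ^ 3) := by
        rw [← mul_assoc, ENNReal.inv_mul_cancel hW3 hW3t, one_mul]
    _ ≤ (volume W ^ 3)⁻¹ * (K * (a + b)) := by gcongr
    _ = _ := by ring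

/-- The Sobolev embedding `H¹(Ω) ⊆ L³(Ω)` for smooth functions on a bounded Lipschitz domain in
dimension at most three. -/
theorem exists_sobolev (hd : d ≤ 3) {Ω : Set (Pt d)} (hΩ : IsOpen Ω)
    (hb : Bornology.IsBounded Ω) (hL : HasLipschitzBoundary Ω) :
    ∃ C : ℝ≥0, ∀ φ : Pt d → ℝ, ContDiff ℝ 1 φ →
      eLpNorm φ 3 (volume.restrict Ω) ≤ C * (eLpNorm φ 2 (volume.restrict Ω) +
        eLpNorm (gradient φ) 2 (volume.restrict Ω)) := by
  have hcpt : IsCompact (closure Ω) := hb.isCompact_closure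
  choose! ρ hρ c ε hε hcone using fun x (hx : x ∈ closure Ω) => exists_interior_cone hΩ hL hx
  obtain ⟨s, hs, hcov⟩ := hcpt.elim_nhds_subcover (fun x => Metric.ball x (ρ x))
    fun x hx => Metric.ball_mem_nhds x (hρ x hx)
  have hloc : ∀ x : s, ∃ C : ℝ≥0∞, C ≠ ∞ ∧ ∀ φ : Pt d → ℝ, ContDiff ℝ 1 φ →
      ∫⁻ y in Ω ∩ Metric.ball x.1 (ρ x.1), ‖φ y‖ₑ ^ 3 ≤
        C * ((∫⁻ y in Ω, ‖φ y‖ₑ ^ 2) ^ (3 / 2 : ℝ) +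
        (∫⁻ y in Ω, ‖gradient φ y‖ₑ ^ 2) ^ (3 / 2 : ℝ)) := fun x =>
    exists_local_sobolev hd hΩ.measurableSet
      (hΩ.measurableSet.inter Metric.isOpen_ball.measurableSet) (hε x (hs x x.2))
      (hcone x (hs x x.2))
  choose C hC hCφ using hloc
  have hCsum : ∑ x, C x ≠ ∞ := ENNReal.sum_ne_top.2 fun x _ => hC x
  have hCroot : (2 * ∑ x, C x) ^ (1 / 3 : ℝ) ≠ ∞ :=
    ENNReal.rpow_ne_top_of_nonneg (by norm_num) (by finiteness)
  refine ⟨((2 * ∑ x, C x) ^ (1 / 3 : ℝ)).toNNReal, fun φ hφ => ?_⟩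
  rw [ENNReal.coe_toNNReal hCroot]
  have e3 : eLpNorm φ 3 (volume.restrict Ω) = (∫⁻ y in Ω, ‖φ y‖ₑ ^ 3) ^ (1 / 3 : ℝ) := by
    rw [eLpNorm_eq_lintegral_rpow_enorm_toReal (by norm_num) (by norm_num)]
    norm_num
  have e2 : ∀ {F : Type} [NormedAddCommGroup F] (f : Pt d → F),
      (∫⁻ y in Ω, ‖f y‖ₑ ^ 2) ^ (3 / 2 : ℝ) = eLpNorm f 2 (volume.restrict Ω) ^ 3 := by
    intro F _ f
    rw [eLpNorm_eq_lintegral_rpow_enorm_toReal (by norm_num) (by norm_num),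
      ← ENNReal.rpow_natCast, ← ENNReal.rpow_mul]
    norm_num
  set a := eLpNorm φ 2 (volume.restrict Ω)
  set b := eLpNorm (gradient φ) 2 (volume.restrict Ω)
  have hsum : ∫⁻ y in Ω, ‖φ y‖ₑ ^ 3 ≤ (∑ x, C x) * (a ^ 3 + b ^ 3) := by
    calc ∫⁻ y in Ω, ‖φ y‖ₑ ^ 3
        ≤ ∫⁻ y in ⋃ x : s, Ω ∩ Metric.ball x.1 (ρ x.1), ‖φ y‖ₑ ^ 3 := by
          refine lintegral_mono_set fun y hy => ?_
          obtain ⟨x, hx, hyx⟩ := Set.mem_iUnion₂.1 (hcov (subset_closure hy))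
          exact Set.mem_iUnion.2 ⟨⟨x, hx⟩, hy, hyx⟩
      _ ≤ ∑ x : s, ∫⁻ y in Ω ∩ Metric.ball x.1 (ρ x.1), ‖φ y‖ₑ ^ 3 := by
          rw [← tsum_fintype (L := .unconditional _)]
          exact lintegral_iUnion_le _ _
      _ ≤ ∑ x : s, C x * (a ^ 3 + b ^ 3) := by
          refine Finset.sum_le_sum fun x _ => ?_
          rw [← e2, ← e2]
          exact hCφ x φ hφ
      _ = _ := by rw [Finset.sum_mul]
  have hab : a ^ 3 + b ^ 3 ≤ 2 * (a + b) ^ 3 := by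
    rw [two_mul]
    gcongr
    · exact le_self_add
    · exact le_add_self
  rw [e3]
  calc (∫⁻ y in Ω, ‖φ y‖ₑ ^ 3) ^ (1 / 3 : ℝ)
      ≤ ((2 * ∑ x, C x) * (a + b) ^ 3) ^ (1 / 3 : ℝ) := by
        refine ENNReal.rpow_le_rpow (hsum.trans ?_) (by norm_num)
        calc _ ≤ (∑ x, C x) * (2 * (a + b) ^ 3) := by gcongr
          _ = _ := by ring
    _ = _ := by
        rw [ENNReal.mul_rpow_of_nonneg _ _ (by norm_num), ← ENNReal.rpow_natCast,
          ← ENNReal.rpow_mul]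
        norm_num

end Sobolev

/-! ### Limits of smooth functions and traces -/

instance : ENNReal.HolderTriple 3 6 2 := ⟨by
  rw [← ENNReal.toReal_eq_toReal_iff' (by finiteness) (by finiteness),
    ENNReal.toReal_add (by finiteness) (by finiteness)]
  norm_num⟩

instance : ENNReal.HolderTriple 3 2 expS := ⟨by
  have : (expS)⁻¹ ≠ ∞ := by simp [expS]
  rw [← ENNReal.toReal_eq_toReal_iff' (by finiteness) (by finiteness),
    ENNReal.toReal_add (by finiteness) (by finiteness)]
  norm_num⟩

instance : ENNReal.HolderConjugate expS expR := ⟨by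
  have : (expS)⁻¹ ≠ ∞ := by simp [expS]
  rw [← ENNReal.toReal_eq_toReal_iff' (by finiteness) (by finiteness),
    ENNReal.toReal_add (by finiteness) (by finiteness)]
  norm_num⟩

theorem one_le_expS : 1 ≤ expS := by
  rw [expS, ENNReal.le_div_iff_mul_le] <;> norm_num

theorem expS_le_two : expS ≤ 2 := by
  rw [expS]
  refine ENNReal.div_le_of_le_mul ?_
  norm_num

instance : Fact (1 ≤ expS) := ⟨one_le_expS⟩
instance : Fact ((1 : ℝ≥0∞) ≤ 6) := ⟨by norm_num⟩
instance : Fact ((1 : ℝ≥0∞) ≤ 3) := ⟨by norm_num⟩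

section Approximation
variable {d : ℕ} {D : MixedDomain d}

instance : IsFiniteMeasure (vol D) :=
  ⟨by rw [Measure.restrict_apply_univ]; exact D.isBounded.measure_lt_top⟩

theorem gradient_sub {φ ψ : Pt d → ℝ} (hφ : ContDiff ℝ 1 φ) (hψ : ContDiff ℝ 1 ψ) (x : Pt d) :
    gradient (fun y => φ y - ψ y) x = gradient φ x - gradient ψ x := by
  have h1 := (hφ.differentiable one_ne_zero) x
  have h2 := (hψ.differentiable one_ne_zero) x
  rw [gradient, gradient, gradient, fderiv_fun_sub h1 h2, map_sub]

/-- The bound `‖·‖_{L³} ≤ C (‖·‖_{L²} + ‖∇ ·‖_{L²})` passes from smooth functions to their limits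
in `H¹`. -/
theorem eLpNorm_three_le_of_tendsto {C : ℝ≥0}
    (hC : ∀ φ : Pt d → ℝ, ContDiff ℝ 1 φ →
      eLpNorm φ 3 (vol D) ≤ C * (eLpNorm φ 2 (vol D) + eLpNorm (gradient φ) 2 (vol D)))
    {φ : ℕ → Pt d → ℝ} (hφ : ∀ n, ContDiff ℝ 1 (φ n)) {u : Pt d → ℝ} {G : Pt d → Pt d}
    (hu : AEStronglyMeasurable u (vol D)) (hG : AEStronglyMeasurable G (vol D))
    (h0 : Tendsto (fun n => eLpNorm (fun x => φ n x - u x) 2 (vol D)) atTop (𝓝 0))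
    (h1 : Tendsto (fun n => eLpNorm (fun x => gradient (φ n) x - G x) 2 (vol D)) atTop (𝓝 0)) :
    eLpNorm u 3 (vol D) ≤ C * (eLpNorm u 2 (vol D) + eLpNorm G 2 (vol D)) := by
  have hm : ∀ n, AEStronglyMeasurable (φ n) (vol D) := fun n =>
    (hφ n).continuous.aestronglyMeasurable
  have hgm : ∀ n, AEStronglyMeasurable (gradient (φ n)) (vol D) := fun n =>
    (continuous_gradient (hφ n)).aestronglyMeasurable
  obtain ⟨ns, hns, hae⟩ :=
    (tendstoInMeasure_of_tendsto_eLpNorm (p := 2) two_ne_zero hm hu h0).exists_seq_tendsto_ae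
  have hlim := Lp.eLpNorm_lim_le_liminf_eLpNorm (p := 3) (fun n => hm (ns n)) u hae
  refine hlim.trans ?_
  have hle : ∀ n, eLpNorm (φ (ns n)) 3 (vol D) ≤
      C * ((eLpNorm (fun x => φ (ns n) x - u x) 2 (vol D) + eLpNorm u 2 (vol D)) +
        (eLpNorm (fun x => gradient (φ (ns n)) x - G x) 2 (vol D) + eLpNorm G 2 (vol D))) := by
    intro n
    refine (hC _ (hφ _)).trans ?_
    gcongr
    · calc eLpNorm (φ (ns n)) 2 (vol D) = eLpNorm ((fun x => φ (ns n) x - u x) + u) 2 (vol D) := by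
            congr 1; ext x; simp
        _ ≤ _ := eLpNorm_add_le ((hm _).sub hu) hu (by norm_num)
    · calc eLpNorm (gradient (φ (ns n))) 2 (vol D)
          = eLpNorm ((fun x => gradient (φ (ns n)) x - G x) + G) 2 (vol D) := by
            congr 1; ext x; simp
        _ ≤ _ := eLpNorm_add_le ((hgm _).sub hG) hG (by norm_num)
  have ht : Tendsto (fun n =>
      C * ((eLpNorm (fun x => φ (ns n) x - u x) 2 (vol D) + eLpNorm u 2 (vol D)) +
        (eLpNorm (fun x => gradient (φ (ns n)) x - G x) 2 (vol D) + eLpNorm G 2 (vol D))))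
      atTop (𝓝 (C * ((0 + eLpNorm u 2 (vol D)) + (0 + eLpNorm G 2 (vol D))))) := by
    refine ENNReal.Tendsto.const_mul ?_ (Or.inr ENNReal.coe_ne_top)
    exact ((h0.comp hns.tendsto_atTop).add_const _).add
      ((h1.comp hns.tendsto_atTop).add_const _)
  calc liminf (fun n => eLpNorm (φ (ns n)) 3 (vol D)) atTop ≤ _ :=
        liminf_le_liminf (Eventually.of_forall hle)
    _ = _ := ht.liminf_eq
    _ = _ := by simp

theorem integral_smul_gradient_of_contDiff {φ ψ : Pt d → ℝ} (hφ : ContDiff ℝ 1 φ)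
    (hψ : IsTest D ψ) :
    ∫ x in D.Ω, φ x • gradient ψ x = - ∫ x in D.Ω, ψ x • gradient φ x := by
  have hψ1 : ContDiff ℝ 1 ψ := hψ.1.of_le (by exact_mod_cast le_top)
  have hz : ∀ x ∉ D.Ω, ψ x = 0 := fun x hx => image_eq_zero_of_notMem_tsupport
    fun h => hx (hψ.2.2 h)
  have hz' : ∀ x ∉ D.Ω, gradient ψ x = 0 := fun x hx => by
    have : fderiv ℝ ψ x = 0 := by
      by_contra hne
      exact hx (hψ.2.2 (support_fderiv_subset ℝ hne))
    rw [gradient, this, map_zero]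
  rw [setIntegral_eq_integral_of_forall_compl_eq_zero (fun x hx => by rw [hz' x hx, smul_zero]),
    setIntegral_eq_integral_of_forall_compl_eq_zero (fun x hx => by rw [hz x hx, zero_smul])]
  have hcf : Continuous (gradient φ) := continuous_gradient hφ
  have hcg : Continuous (gradient ψ) := continuous_gradient hψ1
  have hsg : HasCompactSupport (gradient ψ) := by
    have := (hψ.2.1.fderiv ℝ).comp_left
      (g := (InnerProductSpace.toDual ℝ (Pt d)).symm) (map_zero _)
    exact this
  have hi1 : Integrable (fun x => φ x • gradient ψ x) :=
    (hφ.continuous.smul hcg).integrable_of_hasCompactSupport hsg.smul_left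
  have hi2 : Integrable (fun x => ψ x • gradient φ x) :=
    (hψ1.continuous.smul hcf).integrable_of_hasCompactSupport hψ.2.1.smul_right
  refine ext_inner_left ℝ fun v => ?_
  rw [inner_neg_right, ← integral_inner hi1, ← integral_inner hi2]
  have hfd : ∀ (χ : Pt d → ℝ) (x : Pt d), inner ℝ v (gradient χ x) = fderiv ℝ χ x v := by
    intro χ x
    rw [real_inner_comm, gradient, InnerProductSpace.toDual_symm_apply]
  have hi1v := hi1.const_inner (𝕜 := ℝ) v
  have hi2v := hi2.const_inner (𝕜 := ℝ) v
  simp only [inner_smul_right, hfd] at hi1v hi2v ⊢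
  rw [integral_mul_fderiv_eq_neg_fderiv_mul_of_integrable]
  · simp only [mul_comm]
  · simpa only [mul_comm] using hi2v
  · exact hi1v
  · exact (hφ.continuous.mul hψ1.continuous).integrable_of_hasCompactSupport hψ.2.1.mul_left
  · exact fun x _ => (hφ.differentiable one_ne_zero) x
  · exact fun x _ => (hψ1.differentiable one_ne_zero) x

/-- A limit in `W^{1,p}` of smooth functions has the limit of the gradients as weak gradient. -/
theorem hasWeakGrad_of_tendsto {p : ℝ≥0∞} (hp : 1 ≤ p)
    {φ : ℕ → Pt d → ℝ} (hφ : ∀ n, ContDiff ℝ 1 (φ n)) {u : Pt d → ℝ} {G : Pt d → Pt d}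
    (hu : AEStronglyMeasurable u (vol D)) (hG : AEStronglyMeasurable G (vol D))
    (h0 : Tendsto (fun n => eLpNorm (fun x => φ n x - u x) p (vol D)) atTop (𝓝 0))
    (h1 : Tendsto (fun n => eLpNorm (fun x => gradient (φ n) x - G x) p (vol D)) atTop (𝓝 0)) :
    HasWeakGrad D u G := by
  intro ψ hψ
  have hψ1 : ContDiff ℝ 1 ψ := hψ.1.of_le (by exact_mod_cast le_top)
  have hcg : Continuous (gradient ψ) := continuous_gradient hψ1
  have hsg : HasCompactSupport (gradient ψ) := by
    have := (hψ.2.1.fderiv ℝ).comp_left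
      (g := (InnerProductSpace.toDual ℝ (Pt d)).symm) (map_zero _)
    exact this
  obtain ⟨M, hM⟩ := hψ.2.1.exists_bound_of_continuous hψ1.continuous
  obtain ⟨M', hM'⟩ := hsg.exists_bound_of_continuous hcg
  have hto1 : ∀ {F : Type} [NormedAddCommGroup F] {f : ℕ → Pt d → F},
      (∀ n, AEStronglyMeasurable (f n) (vol D)) →
      Tendsto (fun n => eLpNorm (f n) p (vol D)) atTop (𝓝 0) →
      Tendsto (fun n => eLpNorm (f n) 1 (vol D)) atTop (𝓝 0) := by
    intro F _ f hf h
    have ht : Tendsto (fun n => eLpNorm (f n) p (vol D) *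
        (vol D) Set.univ ^ (1 / (1 : ℝ≥0∞).toReal - 1 / p.toReal)) atTop (𝓝 0) := by
      have hfin : (vol D) Set.univ ^ (1 / (1 : ℝ≥0∞).toReal - 1 / p.toReal) ≠ ∞ := by
        refine ENNReal.rpow_ne_top_of_nonneg ?_ (measure_ne_top _ _)
        by_cases hpt : p = ∞
        · simp [hpt]
        · have : 1 ≤ p.toReal := by
            simpa using ENNReal.toReal_mono hpt hp
          simp only [ENNReal.toReal_one, div_one, sub_nonneg]
          exact (div_le_one (by linarith)).2 this
      simpa using ENNReal.Tendsto.mul_const h (Or.inr hfin)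
    exact tendsto_of_tendsto_of_tendsto_of_le_of_le tendsto_const_nhds ht (fun _ => zero_le)
      fun n => eLpNorm_le_eLpNorm_mul_rpow_measure_univ hp (hf n)
  have hL : Tendsto (fun n => ∫ x in D.Ω, φ n x • gradient ψ x) atTop
      (𝓝 (∫ x in D.Ω, u x • gradient ψ x)) := by
    refine tendsto_integral_of_L1' _ (hu.smul hcg.aestronglyMeasurable)
      (Eventually.of_forall fun n => ?_) ?_
    · exact ((hφ n).continuous.smul hcg).integrable_of_hasCompactSupport
        hsg.smul_left |>.integrableOn
    · have h := ENNReal.Tendsto.const_mul (hto1 (fun n =>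
        (hφ n).continuous.aestronglyMeasurable.sub hu) h0) (Or.inr (ENNReal.ofReal_ne_top (r := M')))
      rw [mul_zero] at h
      refine tendsto_of_tendsto_of_tendsto_of_le_of_le tendsto_const_nhds h (fun _ => zero_le)
        fun n => eLpNorm_le_mul_eLpNorm_of_ae_le_mul (Eventually.of_forall fun x => ?_) 1
      rw [Pi.sub_apply, Pi.smul_apply', ← sub_smul, norm_smul, mul_comm]
      exact mul_le_mul_of_nonneg_right (hM' x) (norm_nonneg _)
  have hR : Tendsto (fun n => - ∫ x in D.Ω, ψ x • gradient (φ n) x) atTop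
      (𝓝 (- ∫ x in D.Ω, ψ x • G x)) := by
    refine Tendsto.neg ?_
    refine tendsto_integral_of_L1' _ (hψ1.continuous.aestronglyMeasurable.smul hG)
      (Eventually.of_forall fun n => ?_) ?_
    · exact (hψ1.continuous.smul (continuous_gradient (hφ n))).integrable_of_hasCompactSupport
        hψ.2.1.smul_right |>.integrableOn
    · have h := ENNReal.Tendsto.const_mul (hto1 (fun n =>
        (continuous_gradient (hφ n)).aestronglyMeasurable.sub hG) h1)
        (Or.inr (ENNReal.ofReal_ne_top (r := M)))
      rw [mul_zero] at h
      refine tendsto_of_tendsto_of_tendsto_of_le_of_le tendsto_const_nhds h (fun _ => zero_le)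
        fun n => eLpNorm_le_mul_eLpNorm_of_ae_le_mul (Eventually.of_forall fun x => ?_) 1
      rw [Pi.sub_apply, Pi.smul_apply', ← smul_sub, norm_smul]
      exact mul_le_mul_of_nonneg_right (hM x) (norm_nonneg _)
  have heq : ∀ n, ∫ x in D.Ω, φ n x • gradient ψ x = - ∫ x in D.Ω, ψ x • gradient (φ n) x :=
    fun n => integral_smul_gradient_of_contDiff (hφ n) hψ
  simp_rw [heq] at hL
  exact tendsto_nhds_unique hL hR

theorem HasZeroTraceOnSig.congr_ae {p : ℝ≥0∞} {u u' : Pt d → ℝ} {G G' : Pt d → Pt d}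
    (h : HasZeroTraceOnSig D p u G) (hu : u =ᵐ[vol D] u') (hG : G =ᵐ[vol D] G') :
    HasZeroTraceOnSig D p u' G' := by
  obtain ⟨φ, h1, h2, h3, h4⟩ := h
  refine ⟨φ, h1, ?_, ?_, h4⟩
  · refine h2.congr fun n => eLpNorm_congr_ae ?_
    filter_upwards [hu] with x hx
    rw [hx]
  · refine h3.congr fun n => eLpNorm_congr_ae ?_
    filter_upwards [hG] with x hx
    rw [hx]

theorem HasZeroTraceOnSig.hasWeakGrad {p : ℝ≥0∞} (hp : 1 ≤ p) {u : Pt d → ℝ} {G : Pt d → Pt d}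
    (h : HasZeroTraceOnSig D p u G)
    (hu : AEStronglyMeasurable u (vol D)) (hG : AEStronglyMeasurable G (vol D)) :
    HasWeakGrad D u G := by
  obtain ⟨φ, h1, h2, h3, -⟩ := h
  exact hasWeakGrad_of_tendsto hp (fun n => (h1 n).1.of_le (by exact_mod_cast le_top)) hu hG h2 h3

theorem gradient_comp {χ : ℝ → ℝ} {χ' : ℝ} {φ : Pt d → ℝ} {x : Pt d}
    (hχ : HasDerivAt χ χ' (φ x)) (hφ : DifferentiableAt ℝ φ x) :
    gradient (fun y => χ (φ y)) x = χ' • gradient φ x := by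
  have h : HasFDerivAt (fun y => χ (φ y)) (χ' • fderiv ℝ φ x) x :=
    hχ.comp_hasFDerivAt x hφ.hasFDerivAt
  rw [gradient, h.fderiv, gradient, map_smul]

/-- The functions `k² (1 - cos (u / k))`, bounded substitutes for `u² / 2`, have zero trace where
`u` has; since they are bounded by `k |u|`, convergence of the traces in `L¹` suffices. -/
theorem HasZeroTraceOnSig.cos_comp {C : ℝ≥0}
    (hC : ∀ φ : Pt d → ℝ, ContDiff ℝ 1 φ →
      eLpNorm φ 3 (vol D) ≤ C * (eLpNorm φ 2 (vol D) + eLpNorm (gradient φ) 2 (vol D)))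
    {u : Pt d → ℝ} {G : Pt d → Pt d} (hu : AEStronglyMeasurable u (vol D))
    (hG : MemLp G 2 (vol D)) (h : HasZeroTraceOnSig D 2 u G) {k : ℝ} (hk : 0 < k) :
    HasZeroTraceOnSig D expS (fun x => k ^ 2 * (1 - Real.cos (u x / k)))
      (fun x => (k * Real.sin (u x / k)) • G x) := by
  obtain ⟨φ, hφ, h0, h1, htr⟩ := h
  have hφ1 : ∀ n, ContDiff ℝ 1 (φ n) := fun n => (hφ n).1.of_le (by exact_mod_cast le_top)
  have hm : ∀ n, AEStronglyMeasurable (φ n) (vol D) := fun n =>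
    (hφ n).1.continuous.aestronglyMeasurable
  have hgm : ∀ n, AEStronglyMeasurable (gradient (φ n)) (vol D) := fun n =>
    (continuous_gradient (hφ1 n)).aestronglyMeasurable
  have h3 : Tendsto (fun n => eLpNorm (fun x => φ n x - u x) 3 (vol D)) atTop (𝓝 0) := by
    have hle : ∀ n, eLpNorm (fun x => φ n x - u x) 3 (vol D) ≤
        C * (eLpNorm (fun x => φ n x - u x) 2 (vol D) +
          eLpNorm (fun x => gradient (φ n) x - G x) 2 (vol D)) := by
      intro n
      refine eLpNorm_three_le_of_tendsto hC (φ := fun m y => φ n y - φ m y)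
        (fun m => (hφ1 n).sub (hφ1 m)) ((hm n).sub hu) ((hgm n).sub hG.1) ?_ ?_
      · refine h0.congr fun m => ?_
        rw [← eLpNorm_neg]
        congr 1; ext x; simp
      · refine h1.congr fun m => ?_
        rw [← eLpNorm_neg]
        congr 1; ext1 x
        simp [gradient_sub (hφ1 n) (hφ1 m)]
    refine tendsto_of_tendsto_of_tendsto_of_le_of_le tendsto_const_nhds ?_ (fun _ => zero_le) hle
    simpa using ENNReal.Tendsto.const_mul (h0.add h1) (Or.inr (ENNReal.coe_ne_top (r := C)))
  have hto : ∀ {F : Type} [NormedAddCommGroup F] {f : ℕ → Pt d → F},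
      (∀ n, AEStronglyMeasurable (f n) (vol D)) →
      Tendsto (fun n => eLpNorm (f n) 2 (vol D)) atTop (𝓝 0) →
      Tendsto (fun n => ENNReal.ofReal k * eLpNorm (f n) expS (vol D)) atTop (𝓝 0) := by
    intro F _ f hf h
    set K := (vol D) Set.univ ^ (1 / expS.toReal - 1 / (2 : ℝ≥0∞).toReal) with hK
    have hfin : K ≠ ∞ := by
      refine ENNReal.rpow_ne_top_of_nonneg ?_ (measure_ne_top _ _)
      norm_num
    have ht : Tendsto (fun n => ENNReal.ofReal k * (eLpNorm (f n) 2 (vol D) * K)) atTop (𝓝 0) := by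
      have := ENNReal.Tendsto.const_mul (ENNReal.Tendsto.mul_const h (Or.inr hfin))
        (Or.inr (ENNReal.ofReal_ne_top (r := k)))
      simpa using this
    refine tendsto_of_tendsto_of_tendsto_of_le_of_le tendsto_const_nhds ht (fun _ => zero_le)
      fun n => ?_
    dsimp only
    gcongr
    exact eLpNorm_le_eLpNorm_mul_rpow_measure_univ expS_le_two (hf n)
  have hcos : ∀ a b : ℝ, |k ^ 2 * (1 - Real.cos (a / k)) - k ^ 2 * (1 - Real.cos (b / k))| ≤
      k * |a - b| := by
    intro a b
    have e : k ^ 2 * (1 - Real.cos (a / k)) - k ^ 2 * (1 - Real.cos (b / k))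
        = k ^ 2 * (Real.cos (b / k) - Real.cos (a / k)) := by ring
    rw [e, abs_mul, abs_of_pos (by positivity)]
    have h := Real.abs_cos_sub_cos_le (b / k) (a / k)
    rw [← sub_div, abs_div, abs_of_pos hk, abs_sub_comm b a] at h
    calc k ^ 2 * _ ≤ k ^ 2 * (|a - b| / k) := by gcongr
      _ = k * |a - b| := by field_simp
  have hsin : ∀ a b : ℝ, |k * Real.sin (a / k) - k * Real.sin (b / k)| ≤ |a - b| := by
    intro a b
    rw [← mul_sub, abs_mul, abs_of_pos hk]
    have h := Real.abs_sin_sub_sin_le (a / k) (b / k)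
    rw [← sub_div, abs_div, abs_of_pos hk] at h
    calc k * _ ≤ k * (|a - b| / k) := by gcongr
      _ = |a - b| := by field_simp
  have hder : ∀ s : ℝ, HasDerivAt (fun s => k ^ 2 * (1 - Real.cos (s / k)))
      (k * Real.sin (s / k)) s := by
    intro s
    have h := (((Real.hasDerivAt_cos (s / k)).comp s ((hasDerivAt_id s).div_const k)).const_sub
      1).const_mul (k ^ 2)
    refine HasDerivAt.congr_deriv h ?_
    field_simp
  have hgrad : ∀ n x, gradient (fun y => k ^ 2 * (1 - Real.cos (φ n y / k))) x
      = (k * Real.sin (φ n x / k)) • gradient (φ n) x := fun n x =>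
    gradient_comp (hder _) (((hφ1 n).differentiable one_ne_zero) x)
  refine ⟨fun n x => k ^ 2 * (1 - Real.cos (φ n x / k)), fun n => ⟨?_, ?_⟩, ?_, ?_, ?_⟩
  · exact contDiff_const.mul (contDiff_const.sub (Real.contDiff_cos.comp ((hφ n).1.div_const k)))
  · exact (hφ n).2.comp_left (g := fun s : ℝ => k ^ 2 * (1 - Real.cos (s / k))) (by simp)
  · refine tendsto_of_tendsto_of_tendsto_of_le_of_le tendsto_const_nhds
      (hto (fun n => (hm n).sub hu) h0) (fun _ => zero_le) fun n => ?_
    exact eLpNorm_le_mul_eLpNorm_of_ae_le_mul (Eventually.of_forall fun x => hcos _ _) _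
  · have ht := (hto (fun n => (hgm n).sub hG.1) h1).add
      (ENNReal.Tendsto.mul_const h3 (Or.inr hG.2.ne))
    rw [zero_mul, add_zero] at ht
    refine tendsto_of_tendsto_of_tendsto_of_le_of_le tendsto_const_nhds ht (fun _ => zero_le)
      fun n => ?_
    have hsm : ∀ {w : Pt d → ℝ}, AEStronglyMeasurable w (vol D) →
        AEStronglyMeasurable (fun x => k * Real.sin (w x / k)) (vol D) := fun {w} hw =>
      (by fun_prop : Continuous fun s : ℝ => k * Real.sin (s / k)).comp_aestronglyMeasurable hw
    calc eLpNorm (fun x => gradient (fun y => k ^ 2 * (1 - Real.cos (φ n y / k))) x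
          - (k * Real.sin (u x / k)) • G x) expS (vol D)
        = eLpNorm ((fun x => (k * Real.sin (φ n x / k)) • (gradient (φ n) x - G x)) +
          (fun x => k * Real.sin (φ n x / k) - k * Real.sin (u x / k)) • G) expS (vol D) := by
          congr 1; ext1 x
          rw [hgrad]
          simp only [Pi.add_apply, Pi.smul_apply', smul_sub, sub_smul]
          abel
      _ ≤ eLpNorm (fun x => (k * Real.sin (φ n x / k)) • (gradient (φ n) x - G x)) expS (vol D) +
          eLpNorm ((fun x => k * Real.sin (φ n x / k) - k * Real.sin (u x / k)) • G)
            expS (vol D) :=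
          eLpNorm_add_le ((hsm (hm n)).smul ((hgm n).sub hG.1))
            (((hsm (hm n)).sub (hsm hu)).smul hG.1) one_le_expS
      _ ≤ _ := by
          refine add_le_add (eLpNorm_le_mul_eLpNorm_of_ae_le_mul
            (Eventually.of_forall fun x => ?_) _) ?_
          · rw [norm_smul, norm_mul, Real.norm_of_nonneg hk.le]
            have := Real.abs_sin_le_one (φ n x / k)
            rw [Real.norm_eq_abs]
            calc k * |Real.sin (φ n x / k)| * _ ≤ k * 1 * _ := by gcongr
              _ = _ := by rw [mul_one, Pi.sub_apply]
          · refine (eLpNorm_smul_le_mul_eLpNorm (p := 3) (q := 2) hG.1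
              ((hsm (hm n)).sub (hsm hu))).trans ?_
            gcongr
            exact eLpNorm_mono fun x => hsin _ _
  · have ht := ENNReal.Tendsto.const_mul htr (Or.inr (ENNReal.ofReal_ne_top (r := k)))
    rw [mul_zero] at ht
    refine tendsto_of_tendsto_of_tendsto_of_le_of_le tendsto_const_nhds ht (fun _ => zero_le)
      fun n => ?_
    dsimp only
    rw [← lintegral_const_mul' _ _ ENNReal.ofReal_ne_top]
    refine lintegral_mono fun x => ?_
    rw [← ofReal_norm, ← ofReal_norm, ← ENNReal.ofReal_mul hk.le]
    refine ENNReal.ofReal_le_ofReal ?_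
    simpa using hcos (φ n x) 0

end Approximation

/-! ### The forms of the model as inner products -/

section Forms
variable {d : ℕ}

open Classical in
/-- A constant for the embedding `H¹(Ω) ⊆ L³(Ω)`, depending on `Ω` only; `0` if there is none. -/
noncomputable def sobolevConst (Ω : Set (Pt d)) : ℝ≥0 :=
  if h : ∃ C : ℝ≥0, ∀ φ : Pt d → ℝ, ContDiff ℝ 1 φ →
      eLpNorm φ 3 (volume.restrict Ω) ≤ C * (eLpNorm φ 2 (volume.restrict Ω) +
        eLpNorm (gradient φ) 2 (volume.restrict Ω)) then h.choose else 0

variable {D : MixedDomain d}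

theorem sobolevConst_spec (hd : d ≤ 3) (D : MixedDomain d) (φ : Pt d → ℝ) (hφ : ContDiff ℝ 1 φ) :
    eLpNorm φ 3 (vol D) ≤
      sobolevConst D.Ω * (eLpNorm φ 2 (vol D) + eLpNorm (gradient φ) 2 (vol D)) := by
  have h := exists_sobolev hd D.isOpen D.isBounded D.lipschitz
  rw [sobolevConst, dif_pos h]
  exact h.choose_spec φ hφ

theorem eLpNorm_three_le_of_mem_H1Star (hd : d ≤ 3) {S : GradPair D} (hS : S ∈ H1Star D) :
    eLpNorm S.1 3 (vol D) ≤ sobolevConst D.Ω * (‖S.1‖ₑ + ‖S.2‖ₑ) := by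
  obtain ⟨φ, hφ, h0, h1, -⟩ := hS.2
  rw [Lp.enorm_def, Lp.enorm_def]
  exact eLpNorm_three_le_of_tendsto (sobolevConst_spec hd D)
    (fun n => (hφ n).1.of_le (by exact_mod_cast le_top)) (Lp.aestronglyMeasurable _)
    (Lp.aestronglyMeasurable _) h0 h1

theorem memLp_three_of_mem_H1Star (hd : d ≤ 3) {S : GradPair D} (hS : S ∈ H1Star D) :
    MemLp S.1 3 (vol D) :=
  ⟨Lp.aestronglyMeasurable _, (eLpNorm_three_le_of_mem_H1Star hd hS).trans_lt
    (by finiteness)⟩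

/-- The Hölder product `L³ × L⁶ → L²`, `(f, v) ↦ f v`. -/
noncomputable def mulL (D : MixedDomain d) :
    Lp ℝ 3 (vol D) →ₗ[ℝ] Lp (Pt d) expR (vol D) →ₗ[ℝ] Lp (Pt d) 2 (vol D) :=
  (ContinuousLinearMap.lsmul ℝ ℝ : ℝ →L[ℝ] Pt d →L[ℝ] Pt d).holderₗ (vol D) 3 expR 2

theorem coeFn_mulL (f : Lp ℝ 3 (vol D)) (v : Lp (Pt d) expR (vol D)) :
    mulL D f v =ᵐ[vol D] fun x => f x • v x :=
  ContinuousLinearMap.coeFn_holder _ f v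

theorem norm_mulL_le (f : Lp ℝ 3 (vol D)) (v : Lp (Pt d) expR (vol D)) :
    ‖mulL D f v‖ ≤ ‖f‖ * ‖v‖ := by
  refine (ContinuousLinearMap.norm_holder_apply_apply_le _ f v).trans ?_
  have := ContinuousLinearMap.opNorm_lsmul_le (𝕜 := ℝ) (R := ℝ) (E := Pt d)
  calc _ ≤ 1 * ‖f‖ * ‖v‖ := by gcongr
    _ = _ := by rw [one_mul]

/-- The embedding `L⁶ ⊆ L²`, as the Hölder product with the constant `1 ∈ L³`. -/
noncomputable def inclL (D : MixedDomain d) :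
    Lp (Pt d) expR (vol D) →ₗ[ℝ] Lp (Pt d) 2 (vol D) :=
  mulL D (Lp.const 3 (vol D) 1)

theorem coeFn_inclL (v : Lp (Pt d) expR (vol D)) : inclL D v =ᵐ[vol D] v := by
  filter_upwards [coeFn_mulL (Lp.const 3 (vol D) (1 : ℝ)) v,
    Lp.coeFn_const (p := 3) (μ := vol D) (c := (1 : ℝ))] with x h1 h2
  rw [inclL, h1, h2, Function.const_apply, one_smul]

theorem volConst_nonneg (D : MixedDomain d) : 0 ≤ volConst D :=
  Real.rpow_nonneg measureReal_nonneg _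

theorem norm_inclL_le (v : Lp (Pt d) expR (vol D)) : ‖inclL D v‖ ≤ volConst D * ‖v‖ := by
  refine (norm_mulL_le _ v).trans ?_
  gcongr
  refine (Lp.norm_const_le _ _ _).trans (le_of_eq ?_)
  rw [volConst, measureReal_restrict_apply_univ]
  norm_num

/-- The pairing of `L^s` with `L^r`. -/
noncomputable def pairL (D : MixedDomain d) :
    Lp (Pt d) expS (vol D) →L[ℝ] Lp (Pt d) expR (vol D) →L[ℝ] ℝ :=
  (innerSL ℝ).lpPairing (vol D) expS expR

/-- The product `v ↦ 𝐠 · v` with the gravity, on `L²`. -/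
noncomputable def gravL (M : Model D) : Lp (Pt d) 2 (vol D) →ₗ[ℝ] Lp ℝ 2 (vol D) :=
  (innerSL ℝ : Pt d →L[ℝ] Pt d →L[ℝ] ℝ).holderₗ (vol D) ∞ 2 2 M.gravity

theorem norm_gravL_le (M : Model D) (v : Lp (Pt d) 2 (vol D)) :
    ‖gravL M v‖ ≤ ‖M.gravity‖ * ‖v‖ := by
  refine (ContinuousLinearMap.norm_holder_apply_apply_le _ M.gravity v).trans ?_
  have : ‖(innerSL ℝ : Pt d →L[ℝ] Pt d →L[ℝ] ℝ)‖ ≤ 1 := norm_innerSL_le ℝ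
  calc _ ≤ 1 * ‖M.gravity‖ * ‖v‖ := by gcongr
    _ = _ := by rw [one_mul]

theorem a1_eq (ω ζ : CurlPair D) : a1 ω ζ = inner ℝ ω.1 ζ.1 := by
  rw [a1, L2.inner_def]

theorem b1_eq (M : Model D) (ζ : CurlPair D) (v : DivPair D) :
    b1 M ζ v = - √M.muEff * pairL D ζ.2 v.1 := by
  rw [b1, pairL, ContinuousLinearMap.lpPairing_eq_integral]
  rfl

theorem a2_eq (M : Model D) (u v : DivPair D) :
    a2 M u v = M.mu / M.kappa * inner ℝ (inclL D u.1) (inclL D v.1) := by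
  rw [a2, L2.inner_def]
  congr 1
  refine integral_congr_ae ?_
  filter_upwards [coeFn_inclL u.1, coeFn_inclL v.1] with x h1 h2
  rw [h1, h2]

theorem b2_eq (v : DivPair D) (q : L2 D) : b2 v q = inner ℝ v.2 q := by
  rw [b2, L2.inner_def]
  rfl

theorem a3_eq (M : Model D) (T S : GradPair D) :
    a3 M T S = M.sigma0 * inner ℝ T.1 S.1 + M.alpha * inner ℝ T.2 S.2 := by
  rw [a3, L2.inner_def, L2.inner_def]
  congr 2
  refine integral_congr_ae (Eventually.of_forall fun x => ?_)
  simp [mul_comm]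

theorem formG_eq (M : Model D) (S : GradPair D) : formG M S = inner ℝ M.source S.1 := by
  rw [formG, L2.inner_def]
  refine integral_congr_ae (Eventually.of_forall fun x => ?_)
  simp [mul_comm]

theorem formF_eq (M : Model D) (S : GradPair D) (v : DivPair D) :
    formF M S v = M.rho * M.beta *
      inner ℝ (S.1 - Lp.const 2 (vol D) M.refTemp) (gravL M (inclL D v.1)) := by
  rw [formF, L2.inner_def]
  congr 1
  refine integral_congr_ae ?_
  filter_upwards [coeFn_inclL v.1, Lp.coeFn_sub S.1 (Lp.const 2 (vol D) M.refTemp),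
    Lp.coeFn_const (p := 2) (μ := vol D) (c := M.refTemp),
    ContinuousLinearMap.coeFn_holder (r := 2) (innerSL ℝ : Pt d →L[ℝ] Pt d →L[ℝ] ℝ)
      M.gravity (inclL D v.1)] with x h1 h2 h3 h4
  have h4' : gravL M (inclL D v.1) x = inner ℝ (M.gravity x) (inclL D v.1 x) := h4
  rw [h4', h1, h2, Pi.sub_apply, h3, Function.const_apply]
  simp [mul_comm]

/-- The convective form for a test function in `L³`, where the integral converges absolutely. -/
theorem c1_eq (v : DivPair D) (T : GradPair D) {S : GradPair D} (hS : MemLp S.1 3 (vol D)) :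
    c1 v T S = inner ℝ (mulL D (hS.toLp S.1) v.1) T.2 := by
  rw [c1, L2.inner_def]
  refine integral_congr_ae ?_
  filter_upwards [coeFn_mulL (hS.toLp S.1) v.1, hS.coeFn_toLp] with x h1 h2
  rw [h1, h2, real_inner_smul_left, mul_comm]

theorem c2_eq (M : Model D) (u v : DivPair D) {S : GradPair D} (hS : MemLp S.1 3 (vol D)) :
    c2 M u v S = M.mu / (M.kappa * M.heatCap * M.rho) *
      inner ℝ (mulL D (hS.toLp S.1) u.1) (inclL D v.1) := by
  rw [c2, L2.inner_def]
  congr 1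
  refine integral_congr_ae ?_
  filter_upwards [coeFn_mulL (hS.toLp S.1) u.1, hS.coeFn_toLp, coeFn_inclL v.1] with x h1 h2 h3
  rw [h1, h2, h3, real_inner_smul_left, mul_comm]

theorem integral_inner_sin_eq_zero (hd : d ≤ 3) {v : DivPair D} (hv : v ∈ HdivStar D)
    (hdiv : v.2 = 0) {S : GradPair D} (hS : S ∈ H1Star D) {k : ℝ} (hk : 0 < k) :
    ∫ x in D.Ω, inner ℝ (v.1 x) (S.2 x) * (k * Real.sin (S.1 x / k)) = 0 := by
  have hSm : AEStronglyMeasurable S.1 (vol D) := Lp.aestronglyMeasurable _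
  have htr := hS.2.cos_comp (sobolevConst_spec hd D) hSm (Lp.memLp S.2) hk
  have hq : MemLp (fun x => k ^ 2 * (1 - Real.cos (S.1 x / k))) expS (vol D) := by
    refine MemLp.mono_exponent (q := 2) ?_ expS_le_two
    refine (Lp.memLp S.1).of_le_mul (c := k) ?_ (Eventually.of_forall fun x => ?_)
    · exact (by fun_prop : Continuous fun s : ℝ =>
        k ^ 2 * (1 - Real.cos (s / k))).comp_aestronglyMeasurable hSm
    · have h := Real.abs_cos_sub_cos_le 0 (S.1 x / k)
      rw [Real.cos_zero, zero_sub, abs_neg, abs_div, abs_of_pos hk] at h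
      rw [Real.norm_eq_abs, Real.norm_eq_abs, abs_mul, abs_of_pos (by positivity)]
      calc k ^ 2 * |1 - Real.cos (S.1 x / k)| ≤ k ^ 2 * (|S.1 x| / k) := by gcongr
        _ = k * |S.1 x| := by field_simp
  have hG : MemLp (fun x => (k * Real.sin (S.1 x / k)) • S.2 x) expS (vol D) := by
    refine MemLp.mono_exponent (q := 2) ?_ expS_le_two
    refine (Lp.memLp S.2).of_le_mul (c := k) ?_ (Eventually.of_forall fun x => ?_)
    · exact ((by fun_prop : Continuous fun s : ℝ => k * Real.sin (s / k)).comp_aestronglyMeasurable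
        hSm).smul (Lp.aestronglyMeasurable _)
    · rw [norm_smul, norm_mul, Real.norm_of_nonneg hk.le, Real.norm_eq_abs]
      calc k * |Real.sin (S.1 x / k)| * _ ≤ k * 1 * _ := by
            gcongr
            exact Real.abs_sin_le_one _
        _ = _ := by rw [mul_one]
  have htr' := htr.congr_ae hq.coeFn_toLp.symm hG.coeFn_toLp.symm
  have h := hv.2 hq.toLp hG.toLp (htr'.hasWeakGrad one_le_expS (Lp.aestronglyMeasurable _)
    (Lp.aestronglyMeasurable _)) htr'
  have hz : ∫ x in D.Ω, v.2 x * hq.toLp _ x = 0 := by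
    rw [hdiv]
    refine integral_eq_zero_of_ae ?_
    filter_upwards [Lp.coeFn_zero ℝ 2 (vol D)] with x hx
    rw [hx, Pi.zero_apply, zero_mul]
  rw [hz, add_zero] at h
  rw [← h]
  refine integral_congr_ae ?_
  filter_upwards [hG.coeFn_toLp] with x hx
  rw [hx, real_inner_smul_right, mul_comm]

/-- For a solenoidal velocity the convective form vanishes on the diagonal. The test function
`S² / 2` of the normal trace is replaced by `k² (1 - cos (S / k))`, and `k → ∞`. -/
theorem c1_self_eq_zero (hd : d ≤ 3) {v : DivPair D} (hv : v ∈ HdivStar D)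
    (hdiv : v.2 = 0) {S : GradPair D} (hS : S ∈ H1Star D) : c1 v S S = 0 := by
  have h3 := memLp_three_of_mem_H1Star hd hS
  have hint : Integrable (fun x => inner ℝ (v.1 x) (S.2 x) * S.1 x) (vol D) := by
    refine (L2.integrable_inner (𝕜 := ℝ) (mulL D (h3.toLp S.1) v.1) S.2).congr ?_
    filter_upwards [coeFn_mulL (h3.toLp S.1) v.1, h3.coeFn_toLp] with x h1 h2
    rw [h1, h2, real_inner_smul_left, mul_comm]
  have hSm : AEStronglyMeasurable S.1 (vol D) := Lp.aestronglyMeasurable _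
  have hlim : Tendsto (fun n : ℕ => ∫ x in D.Ω, inner ℝ (v.1 x) (S.2 x) *
      (((n : ℝ) + 1) * Real.sin (S.1 x / ((n : ℝ) + 1)))) atTop (𝓝 (c1 v S S)) := by
    refine tendsto_integral_of_dominated_convergence
      (fun x => ‖inner ℝ (v.1 x) (S.2 x) * S.1 x‖) (fun n => ?_) hint.norm (fun n => ?_) ?_
    · exact ((Lp.aestronglyMeasurable v.1).inner (Lp.aestronglyMeasurable S.2)).mul
        ((by fun_prop : Continuous fun s : ℝ =>
          ((n : ℝ) + 1) * Real.sin (s / ((n : ℝ) + 1))).comp_aestronglyMeasurable hSm)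
    · refine Eventually.of_forall fun x => ?_
      simp only [norm_mul (inner ℝ (v.1 x) (S.2 x))]
      refine mul_le_mul_of_nonneg_left ?_ (norm_nonneg _)
      have hk : (0 : ℝ) < (n : ℝ) + 1 := by positivity
      rw [Real.norm_eq_abs, Real.norm_eq_abs, abs_mul, abs_of_pos hk]
      have h := Real.abs_sin_le_abs (x := S.1 x / ((n : ℝ) + 1))
      rw [abs_div, abs_of_pos hk] at h
      calc ((n : ℝ) + 1) * _ ≤ ((n : ℝ) + 1) * (|S.1 x| / ((n : ℝ) + 1)) := by gcongr
        _ = |S.1 x| := by field_simp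
    · refine Eventually.of_forall fun x => ?_
      refine Tendsto.const_mul _ ?_
      have e : ∀ n : ℕ, ((n : ℝ) + 1) * Real.sin (S.1 x / ((n : ℝ) + 1))
          = S.1 x * Real.sinc (S.1 x / ((n : ℝ) + 1)) := by
        intro n
        have hk : (n : ℝ) + 1 ≠ 0 := by positivity
        by_cases hs : S.1 x = 0
        · simp [hs]
        · rw [Real.sinc_of_ne_zero (div_ne_zero hs hk)]
          field_simp
      simp_rw [e]
      have h0 : Tendsto (fun n : ℕ => S.1 x / ((n : ℝ) + 1)) atTop (𝓝 0) :=
        tendsto_const_nhds.div_atTop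
          (tendsto_atTop_add_const_right _ _ tendsto_natCast_atTop_atTop)
      have h1 := ((Real.continuous_sinc.tendsto 0).comp h0).const_mul (S.1 x)
      simpa using h1
  refine tendsto_nhds_unique hlim ?_
  simp_rw [fun n : ℕ => integral_inner_sin_eq_zero hd hv hdiv hS
    (show (0 : ℝ) < (n : ℝ) + 1 by positivity)]
  exact tendsto_const_nhds

end Forms

section WellPosed
variable {d : ℕ} {D : MixedDomain d}

/-! ### The thermal energy problem -/

theorem h1Norm_eq_norm (S : GradPair D) : h1Norm S = ‖WithLp.toLp 2 S‖ := by
  rw [h1Norm, WithLp.prod_norm_eq_of_L2]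
  rfl

theorem h1Norm_nonneg (S : GradPair D) : 0 ≤ h1Norm S := Real.sqrt_nonneg _

theorem h1Norm_sq (S : GradPair D) : h1Norm S ^ 2 = ‖S.1‖ ^ 2 + ‖S.2‖ ^ 2 :=
  Real.sq_sqrt (by positivity)

theorem norm_fst_le_h1Norm (S : GradPair D) : ‖S.1‖ ≤ h1Norm S :=
  Real.le_sqrt_of_sq_le (by nlinarith [sq_nonneg ‖S.2‖])

theorem norm_snd_le_h1Norm (S : GradPair D) : ‖S.2‖ ≤ h1Norm S :=
  Real.le_sqrt_of_sq_le (by nlinarith [sq_nonneg ‖S.1‖])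

theorem divNorm_nonneg (v : DivPair D) : 0 ≤ divNorm v := by unfold divNorm; positivity

theorem norm_fst_le_divNorm (v : DivPair D) : ‖v.1‖ ≤ divNorm v :=
  le_add_of_nonneg_right (norm_nonneg _)

theorem eq_zero_of_divNorm_le {v : DivPair D} (h : divNorm v ≤ 0) : v = 0 := by
  have h1 := norm_nonneg v.1
  have h2 := norm_nonneg v.2
  unfold divNorm at h
  exact Prod.ext (norm_eq_zero.1 (by linarith)) (norm_eq_zero.1 (by linarith))

/-- A square linear system with trivial kernel is uniquely solvable. -/
theorem existsUnique_of_bilinear {E : Type*} [AddCommGroup E] [Module ℝ E]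
    [FiniteDimensional ℝ E] (B : E →ₗ[ℝ] E →ₗ[ℝ] ℝ) (hB : ∀ x, (∀ y, B x y = 0) → x = 0)
    (l : E →ₗ[ℝ] ℝ) : ∃! x, ∀ y, B x y = l y := by
  have hinj : Function.Injective B := by
    rw [← LinearMap.ker_eq_bot, LinearMap.ker_eq_bot']
    exact fun x hx => hB x fun y => by rw [hx]; rfl
  have hsurj : Function.Surjective B :=
    (LinearMap.injective_iff_surjective_of_finrank_eq_finrank
      (Subspace.dual_finrank_eq (K := ℝ) (V := E)).symm).1 hinj
  obtain ⟨x, hx⟩ := hsurj l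
  refine ⟨x, fun y => by rw [hx], fun x' hx' => hinj ?_⟩
  rw [hx]
  exact LinearMap.ext hx'

variable {M : Model D} {H : DiscreteSpaces D}

/-- Twice the embedding constant of `H¹(Ω) ⊆ L³(Ω)`, enlarged so that it also bounds the form
`c₂` and is at least one. -/
noncomputable def thermalConst (Ω : Set (Pt d)) : ℝ :=
  1 + 2 * sobolevConst Ω * (1 + (volume.real Ω) ^ (((6 : ℝ) - 2) / (2 * 6)))

theorem one_le_thermalConst (Ω : Set (Pt d)) : 1 ≤ thermalConst Ω := by
  have : 0 ≤ (volume.real Ω) ^ (((6 : ℝ) - 2) / (2 * 6)) := Real.rpow_nonneg measureReal_nonneg _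
  have h : (0 : ℝ) ≤ sobolevConst Ω := NNReal.coe_nonneg _
  unfold thermalConst
  have : 0 ≤ 2 * (sobolevConst Ω : ℝ) * (1 + (volume.real Ω) ^ (((6 : ℝ) - 2) / (2 * 6))) := by
    positivity
  linarith

theorem two_mul_sobolevConst_le (D : MixedDomain d) :
    2 * (sobolevConst D.Ω : ℝ) ≤ thermalConst D.Ω ∧
      2 * (sobolevConst D.Ω : ℝ) * volConst D ≤ thermalConst D.Ω := by
  have hv : 0 ≤ volConst D := volConst_nonneg D
  have h : (0 : ℝ) ≤ sobolevConst D.Ω := NNReal.coe_nonneg _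
  have h2 := mul_nonneg h hv
  have e : thermalConst D.Ω = 1 + 2 * sobolevConst D.Ω * (1 + volConst D) := rfl
  rw [e]
  constructor <;> nlinarith

/-- The embedding of the discrete temperatures in `L³`. -/
noncomputable def toL3 (hd : d ≤ 3) (H : DiscreteSpaces D) : H.Y →ₗ[ℝ] Lp ℝ 3 (vol D) where
  toFun S := (memLp_three_of_mem_H1Star hd (H.Y_conf S S.2)).toLp
  map_add' S T := by
    rw [← MemLp.toLp_add]
    exact MemLp.toLp_congr _ _ (Lp.coeFn_add _ _)
  map_smul' c S := by
    rw [RingHom.id_apply, ← MemLp.toLp_const_smul]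
    exact MemLp.toLp_congr _ _ (Lp.coeFn_smul _ _)

theorem norm_toL3_le (hd : d ≤ 3) (S : H.Y) :
    ‖toL3 hd H S‖ ≤ 2 * sobolevConst D.Ω * h1Norm S.1 := by
  have h := eLpNorm_three_le_of_mem_H1Star hd (H.Y_conf S S.2)
  have h' : ‖toL3 hd H S‖ ≤ sobolevConst D.Ω * (‖S.1.1‖ + ‖S.1.2‖) := by
    change ‖(memLp_three_of_mem_H1Star hd (H.Y_conf S S.2)).toLp _‖ ≤ _
    rw [Lp.norm_toLp]
    refine (ENNReal.toReal_mono (by finiteness) h).trans (le_of_eq ?_)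
    rw [ENNReal.toReal_mul, ENNReal.toReal_add (by finiteness) (by finiteness)]
    simp
  have h1 := norm_fst_le_h1Norm S.1
  have h2 := norm_snd_le_h1Norm S.1
  calc _ ≤ _ := h'
    _ ≤ sobolevConst D.Ω * (h1Norm S.1 + h1Norm S.1) := by gcongr
    _ = _ := by ring

theorem c1_eq_toL3 (hd : d ≤ 3) (v : DivPair D) (T : GradPair D) (S : H.Y) :
    c1 v T S.1 = inner ℝ (mulL D (toL3 hd H S) v.1) T.2 :=
  c1_eq v T (memLp_three_of_mem_H1Star hd (H.Y_conf S S.2))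

theorem c2_eq_toL3 (hd : d ≤ 3) (u v : DivPair D) (S : H.Y) :
    c2 M u v S.1 = M.mu / (M.heatCap * M.rho * M.kappa) *
      inner ℝ (mulL D (toL3 hd H S) u.1) (inclL D v.1) := by
  rw [c2_eq M u v (memLp_three_of_mem_H1Star hd (H.Y_conf S S.2))]
  rw [show M.kappa * M.heatCap * M.rho = M.heatCap * M.rho * M.kappa by ring]
  rfl

theorem nu_pos (M : Model D) : 0 < M.mu / (M.heatCap * M.rho * M.kappa) := by
  have := M.mu_pos
  have := M.heatCap_pos
  have := M.rho_pos
  have := M.kappa_pos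
  positivity

theorem abs_c1_le (hd : d ≤ 3) (v : DivPair D) (T : GradPair D) (S : H.Y) :
    |c1 v T S.1| ≤ thermalConst D.Ω * divNorm v * h1Norm T * h1Norm S.1 := by
  rw [c1_eq_toL3 hd]
  refine (abs_real_inner_le_norm _ _).trans ?_
  have h1 := norm_toL3_le hd S
  have h2 := norm_fst_le_divNorm v
  have h3 := norm_snd_le_h1Norm T
  have h4 := (two_mul_sobolevConst_le D).1
  have h5 := h1Norm_nonneg S.1
  have h6 := divNorm_nonneg v
  calc _ ≤ (‖toL3 hd H S‖ * ‖v.1‖) * ‖T.2‖ := by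
        gcongr
        exact norm_mulL_le _ _
    _ ≤ ((2 * sobolevConst D.Ω * h1Norm S.1) * divNorm v) * h1Norm T := by gcongr
    _ ≤ ((thermalConst D.Ω * h1Norm S.1) * divNorm v) * h1Norm T := by
        have := h1Norm_nonneg T
        gcongr
    _ = _ := by ring

theorem abs_c2_le (hd : d ≤ 3) (u v : DivPair D) (S : H.Y) :
    |c2 M u v S.1| ≤ thermalConst D.Ω * (M.mu / (M.heatCap * M.rho * M.kappa)) *
      divNorm u * divNorm v * h1Norm S.1 := by
  rw [c2_eq_toL3 hd, abs_mul, abs_of_pos (nu_pos M)]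
  have h0 := (nu_pos M).le
  have h1 := norm_toL3_le hd S
  have h2 := norm_fst_le_divNorm u
  have h3 := norm_fst_le_divNorm v
  have h4 := (two_mul_sobolevConst_le D).2
  have h5 := h1Norm_nonneg S.1
  have h6 := divNorm_nonneg u
  have h7 := divNorm_nonneg v
  have h8 := volConst_nonneg D
  set ν := M.mu / (M.heatCap * M.rho * M.kappa)
  calc _ ≤ ν * ((‖toL3 hd H S‖ * ‖u.1‖) * (volConst D * ‖v.1‖)) := by
        gcongr
        refine (abs_real_inner_le_norm _ _).trans ?_
        gcongr
        · exact norm_mulL_le _ _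
        · exact norm_inclL_le _
    _ ≤ ν * (((2 * sobolevConst D.Ω * h1Norm S.1) * divNorm u) * (volConst D * divNorm v)) := by
        gcongr
    _ = ν * ((2 * sobolevConst D.Ω * volConst D) * h1Norm S.1 * divNorm u * divNorm v) := by ring
    _ ≤ ν * (thermalConst D.Ω * h1Norm S.1 * divNorm u * divNorm v) := by gcongr
    _ = _ := by ring

theorem invCoer_pos (M : Model D) : 0 < invCoer M :=
  lt_max_of_lt_left (inv_pos.2 M.sigma0_pos)

theorem h1Norm_sq_le_a3 (S : GradPair D) : h1Norm S ^ 2 ≤ invCoer M * a3 M S S := by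
  have h1 : 1 ≤ invCoer M * M.sigma0 := by
    have := mul_le_mul_of_nonneg_right (le_max_left M.sigma0⁻¹ M.alpha⁻¹) M.sigma0_pos.le
    rwa [inv_mul_cancel₀ M.sigma0_pos.ne'] at this
  have h2 : 1 ≤ invCoer M * M.alpha := by
    have := mul_le_mul_of_nonneg_right (le_max_right M.sigma0⁻¹ M.alpha⁻¹) M.alpha_pos.le
    rwa [inv_mul_cancel₀ M.alpha_pos.ne'] at this
  rw [h1Norm_sq, a3_eq, real_inner_self_eq_norm_sq, real_inner_self_eq_norm_sq]
  have h3 := mul_le_mul_of_nonneg_right h1 (sq_nonneg ‖S.1‖)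
  have h4 := mul_le_mul_of_nonneg_right h2 (sq_nonneg ‖S.2‖)
  nlinarith

theorem snd_eq_zero_of_mem_kerV (hH : DivCompatible H) {v : DivPair D} (hv : v ∈ kerV H) :
    v.2 = 0 := by
  have h := hv.2 v.2 (hH v hv.1)
  rw [b2_eq] at h
  exact inner_self_eq_zero.1 h

theorem c1_self_eq_zero_of_mem_kerV (hd : d ≤ 3) (hH : DivCompatible H) {v : DivPair D}
    (hv : v ∈ kerV H) {S : GradPair D} (hS : S ∈ H.Y) : c1 v S S = 0 :=
  c1_self_eq_zero hd (H.V_conf v hv.1) (snd_eq_zero_of_mem_kerV hH hv) (H.Y_conf S hS)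

theorem le_of_sq_le_mul {x y : ℝ} (hx : 0 ≤ x) (hy : 0 ≤ y) (h : x ^ 2 ≤ y * x) : x ≤ y := by
  rcases hx.eq_or_lt with rfl | hx
  · exact hy
  · exact le_of_mul_le_mul_right (by nlinarith) hx

theorem existsUnique_solvesThermal (hd : d ≤ 3) (hH : DivCompatible H) {u : DivPair D}
    (hu : u ∈ kerV H) : ∃! T, SolvesThermal M H u T := by
  have := H.Y_fin
  let B : H.Y →ₗ[ℝ] H.Y →ₗ[ℝ] ℝ := LinearMap.mk₂ ℝ
    (fun T S => a3 M T.1 S.1 + c1 u T.1 S.1)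
    (fun T T' S => by
      simp only [a3_eq, c1_eq_toL3 hd]
      simp only [Submodule.coe_add, Prod.fst_add, Prod.snd_add,
        inner_add_left, inner_add_right]
      ring)
    (fun c T S => by
      simp only [a3_eq, c1_eq_toL3 hd]
      simp only [Submodule.coe_smul, Prod.smul_fst, Prod.smul_snd,
        real_inner_smul_left, real_inner_smul_right, smul_eq_mul]
      ring)
    (fun T S S' => by
      simp only [a3_eq, c1_eq_toL3 hd]
      simp only [Submodule.coe_add, Prod.fst_add, Prod.snd_add, map_add,
        inner_add_left, inner_add_right, LinearMap.add_apply]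
      ring)
    (fun c T S => by
      simp only [a3_eq, c1_eq_toL3 hd]
      simp only [Submodule.coe_smul, Prod.smul_fst, Prod.smul_snd, map_smul,
        real_inner_smul_left, real_inner_smul_right, smul_eq_mul, LinearMap.smul_apply]
      ring)
  let l : H.Y →ₗ[ℝ] ℝ :=
    { toFun := fun S => formG M S.1 + c2 M u u S.1
      map_add' := fun S S' => by
        simp only [formG_eq, c2_eq_toL3 hd]
        simp only [Submodule.coe_add, Prod.fst_add, map_add,
          inner_add_left, inner_add_right, LinearMap.add_apply]
        ring
      map_smul' := fun c S => by
        simp only [formG_eq, c2_eq_toL3 hd]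
        simp only [Submodule.coe_smul, Prod.smul_fst, map_smul,
          real_inner_smul_left, real_inner_smul_right, smul_eq_mul, LinearMap.smul_apply,
          RingHom.id_apply]
        ring }
  have hB : ∀ T, (∀ S, B T S = 0) → T = 0 := by
    intro T hT
    have h : a3 M T.1 T.1 + c1 u T.1 T.1 = 0 := hT T
    rw [c1_self_eq_zero_of_mem_kerV hd hH hu T.2, add_zero] at h
    have h2 := h1Norm_sq_le_a3 (M := M) T.1
    rw [h, mul_zero, h1Norm_sq] at h2
    have h3 : ‖T.1.1‖ = 0 := by nlinarith [sq_nonneg ‖T.1.1‖, sq_nonneg ‖T.1.2‖]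
    have h4 : ‖T.1.2‖ = 0 := by nlinarith [sq_nonneg ‖T.1.1‖, sq_nonneg ‖T.1.2‖]
    exact Subtype.ext (Prod.ext (norm_eq_zero.1 h3) (norm_eq_zero.1 h4))
  have hiff : ∀ T : H.Y, (∀ S, B T S = l S) ↔ SolvesThermal M H u T.1 := by
    intro T
    constructor
    · intro h
      refine ⟨T.2, fun S hS => ?_⟩
      have : a3 M T.1 S + c1 u T.1 S = formG M S + c2 M u u S := h ⟨S, hS⟩
      linarith
    · intro h S
      have := h.2 S.1 S.2
      change a3 M T.1 S.1 + c1 u T.1 S.1 = formG M S.1 + c2 M u u S.1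
      linarith
  obtain ⟨T, hT, huniq⟩ := existsUnique_of_bilinear B hB l
  exact ⟨T.1, (hiff T).1 hT, fun T' hT' =>
    congrArg Subtype.val (huniq ⟨T', hT'.1⟩ ((hiff ⟨T', hT'.1⟩).2 hT'))⟩

theorem abs_formG_le (S : GradPair D) : |formG M S| ≤ ‖M.source‖ * h1Norm S := by
  rw [formG_eq]
  refine (abs_real_inner_le_norm _ _).trans ?_
  gcongr
  exact norm_fst_le_h1Norm S

theorem SolvesThermal.h1Norm_le (hd : d ≤ 3) (hH : DivCompatible H) {u : DivPair D}
    (hu : u ∈ kerV H) {T : GradPair D} (hT : SolvesThermal M H u T) :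
    h1Norm T ≤ thermalConst D.Ω * invCoer M *
      (‖M.source‖ + M.mu / (M.heatCap * M.rho * M.kappa) * divNorm u ^ 2) := by
  have h := hT.2 T hT.1
  rw [c1_self_eq_zero_of_mem_kerV hd hH hu hT.1, add_zero] at h
  have hc2 := (abs_le.1 (abs_c2_le (M := M) hd u u ⟨T, hT.1⟩)).2
  have hG := (abs_le.1 (abs_formG_le (M := M) T)).2
  have hcoer := h1Norm_sq_le_a3 (M := M) T
  have hm := invCoer_pos M
  have hν := (nu_pos M).le
  have hC := one_le_thermalConst D.Ω
  have hn := h1Norm_nonneg T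
  have hdiv := divNorm_nonneg u
  set ν := M.mu / (M.heatCap * M.rho * M.kappa)
  set C := thermalConst D.Ω
  refine le_of_sq_le_mul hn (by positivity) ?_
  have hG2 : ‖M.source‖ * h1Norm T ≤ C * (‖M.source‖ * h1Norm T) :=
    le_mul_of_one_le_left (by positivity) hC
  calc h1Norm T ^ 2 ≤ invCoer M * a3 M T T := hcoer
    _ ≤ invCoer M * (C * (‖M.source‖ * h1Norm T) + C * ν * divNorm u * divNorm u * h1Norm T) := by
        gcongr
        linarith
    _ = _ := by ring

/-- Stability in the velocity: the difference of two solutions is tested with itself, and the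
convective form of the difference of the temperatures drops out. -/
theorem SolvesThermal.h1Norm_sub_le (hd : d ≤ 3) (hH : DivCompatible H) {u u' : DivPair D}
    (hu : u ∈ kerV H) {T T' : GradPair D} (hT : SolvesThermal M H u T)
    (hT' : SolvesThermal M H u' T') :
    h1Norm (T - T') ≤ thermalConst D.Ω * invCoer M * divNorm (u - u') *
      (h1Norm T' + M.mu / (M.heatCap * M.rho * M.kappa) * (divNorm u + divNorm u')) := by
  set e : H.Y := ⟨T - T', H.Y.sub_mem hT.1 hT'.1⟩ with he
  have h1 := hT.2 e.1 e.2
  have h2 := hT'.2 e.1 e.2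
  have h0 := c1_self_eq_zero_of_mem_kerV hd hH hu e.2
  have key : a3 M e.1 e.1 = -c1 (u - u') T' e.1 + c2 M u (u - u') e.1 + c2 M (u - u') u' e.1 := by
    have e1 : a3 M e.1 e.1 = a3 M T e.1 - a3 M T' e.1 := by
      simp only [a3_eq, he, Prod.fst_sub, Prod.snd_sub, inner_sub_left]; ring
    have e2 : c1 u e.1 e.1 = c1 u T e.1 - c1 u T' e.1 := by
      rw [c1_eq_toL3 hd, c1_eq_toL3 hd, c1_eq_toL3 hd, ← inner_sub_right]; rfl
    have e3 : c1 (u - u') T' e.1 = c1 u T' e.1 - c1 u' T' e.1 := by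
      rw [c1_eq_toL3 hd, c1_eq_toL3 hd, c1_eq_toL3 hd, ← inner_sub_left, ← map_sub]; rfl
    have e4 : c2 M u (u - u') e.1 + c2 M (u - u') u' e.1 = c2 M u u e.1 - c2 M u' u' e.1 := by
      simp only [c2_eq_toL3 hd, Prod.fst_sub, map_sub, inner_sub_left, inner_sub_right]; ring
    linarith
  have hb1 := (abs_le.1 (abs_c1_le hd (u - u') T' e)).1
  have hb2 := (abs_le.1 (abs_c2_le (M := M) hd u (u - u') e)).2
  have hb3 := (abs_le.1 (abs_c2_le (M := M) hd (u - u') u' e)).2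
  have hcoer := h1Norm_sq_le_a3 (M := M) e.1
  have hm := invCoer_pos M
  have hν := (nu_pos M).le
  have hC := one_le_thermalConst D.Ω
  have hn := h1Norm_nonneg e.1
  have hn' := h1Norm_nonneg T'
  have hdu := divNorm_nonneg u
  have hdu' := divNorm_nonneg u'
  have hdw := divNorm_nonneg (u - u')
  set ν := M.mu / (M.heatCap * M.rho * M.kappa)
  set C := thermalConst D.Ω
  change h1Norm e.1 ≤ _
  refine le_of_sq_le_mul hn (by positivity) ?_
  calc h1Norm e.1 ^ 2 ≤ invCoer M * a3 M e.1 e.1 := hcoer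
    _ ≤ invCoer M * (C * divNorm (u - u') * h1Norm T' * h1Norm e.1 +
          C * ν * divNorm u * divNorm (u - u') * h1Norm e.1 +
          C * ν * divNorm (u - u') * divNorm u' * h1Norm e.1) := by
        gcongr
        linarith
    _ = _ := by ring

end WellPosed

section Reduced
variable {d : ℕ} {D : MixedDomain d} {M : Model D} {H : DiscreteSpaces D}

/-! ### The reduced Brinkman problem -/

/-- The second component of a member of `H(curl_s, Ω)` is determined by the first. -/
theorem eq_zero_of_mem_HcurlStar {ζ : CurlPair D} (hζ : ζ ∈ HcurlStar D) (h : ζ.1 = 0) :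
    ζ = 0 := by
  refine Prod.ext h ?_
  have hcomp : ∀ i : Fin d, ∀ᵐ x ∂(vol D), ζ.2 x i = 0 := by
    intro i
    have hint : Integrable (fun x => ζ.2 x i) (vol D) := by
      have h2 : Integrable ζ.2 (vol D) := (Lp.memLp ζ.2).integrable one_le_expS
      exact (EuclideanSpace.proj (𝕜 := ℝ) i).integrable_comp h2
    have hloc : LocallyIntegrableOn (fun x => ζ.2 x i) D.Ω volume :=
      IntegrableOn.locallyIntegrableOn hint
    rw [ae_restrict_iff' D.isOpen.measurableSet]
    refine D.isOpen.ae_eq_zero_of_integral_contDiff_smul_eq_zero hloc fun g hg hgc hgs => ?_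
    have hw := hζ.1 g ⟨hg, hgc, hgs⟩ i
    have hz : ∫ x in D.Ω, ∑ j : Fin d, ∑ a, curlCoeff d i j a * ζ.1 x a * gradient g x j = 0 := by
      rw [h]
      refine integral_eq_zero_of_ae ?_
      filter_upwards [Lp.coeFn_zero (EuclideanSpace ℝ (Fin (vortDim d))) 2 (vol D)] with x hx
      rw [hx]
      simp
    rw [hz] at hw
    have hw' : ∫ x in D.Ω, ζ.2 x i * g x = 0 := by linarith
    rw [setIntegral_eq_integral_of_forall_compl_eq_zero] at hw'
    · rw [← hw']
      exact integral_congr_ae (Eventually.of_forall fun x => by simp [mul_comm])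
    · intro x hx
      rw [image_eq_zero_of_notMem_tsupport fun hx' => hx (hgs hx'), mul_zero]
  change ζ.2 = 0
  rw [Lp.eq_zero_iff_ae_eq_zero]
  filter_upwards [ae_all_iff.2 hcomp] with x hx
  ext i
  exact hx i

/-- The discrete kernel of `b₂` as a subspace. -/
def kerVSubmodule (H : DiscreteSpaces D) : Submodule ℝ (DivPair D) where
  carrier := kerV H
  zero_mem' := ⟨H.V.zero_mem, fun q _ => by rw [b2_eq]; exact inner_zero_left _⟩
  add_mem' := fun {v w} hv hw => ⟨H.V.add_mem hv.1 hw.1, fun q hq => by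
    have h1 := hv.2 q hq
    have h2 := hw.2 q hq
    rw [b2_eq] at h1 h2 ⊢
    rw [Prod.snd_add, inner_add_left, h1, h2, add_zero]⟩
  smul_mem' := fun c v hv => ⟨H.V.smul_mem c hv.1, fun q hq => by
    have h1 := hv.2 q hq
    rw [b2_eq] at h1 ⊢
    rw [Prod.smul_snd, real_inner_smul_left, h1, mul_zero]⟩

theorem curlNorm_nonneg (ζ : CurlPair D) : 0 ≤ curlNorm ζ := by unfold curlNorm; positivity

/-- The inf-sup condition for `b₁` bounds the velocity by the vorticity, and the vorticity is
controlled by testing with the solution itself. -/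
theorem divNorm_le_of_reduced {β₁ A : ℝ} (hβ : 0 < β₁) (hA : 0 ≤ A) (hB1 : InfSupB1 M H β₁)
    {ω : CurlPair D} {u : DivPair D} (hω : ω ∈ H.Z) (hu : u ∈ kerV H)
    (h1 : ∀ ζ ∈ H.Z, a1 ω ζ + b1 M ζ u = 0) {F : ℝ} (h2 : b1 M ω u - a2 M u u = F)
    (hF : |F| ≤ A * divNorm u) :
    divNorm u ≤ A / β₁ ^ 2 ∧ ‖ω.1‖ ^ 2 ≤ A * divNorm u := by
  have hx := divNorm_nonneg u
  have hβx : β₁ * divNorm u ≤ ‖ω.1‖ := by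
    refine (hB1 u hu).trans (Real.iSup_le (fun ζ => ?_) (norm_nonneg _))
    refine div_le_of_le_mul₀ (curlNorm_nonneg _) (norm_nonneg _) ?_
    have e := h1 ζ.1 ζ.2.1
    rw [a1_eq] at e
    have h3 := (abs_le.1 (abs_real_inner_le_norm ω.1 ζ.1.1)).1
    have h4 : ‖ω.1‖ * ‖ζ.1.1‖ ≤ ‖ω.1‖ * curlNorm ζ.1 := by
      gcongr
      exact le_add_of_nonneg_right (norm_nonneg _)
    linarith
  have hω2 : ‖ω.1‖ ^ 2 ≤ A * divNorm u := by
    have e := h1 ω hω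
    rw [a1_eq, real_inner_self_eq_norm_sq] at e
    have ha2 : 0 ≤ a2 M u u := by
      rw [a2_eq]
      exact mul_nonneg (div_nonneg M.mu_pos.le M.kappa_pos.le) real_inner_self_nonneg
    have := (abs_le.1 hF).1
    linarith
  refine ⟨?_, hω2⟩
  have h5 : (β₁ * divNorm u) ^ 2 ≤ A * divNorm u :=
    (pow_le_pow_left₀ (by positivity) hβx 2).trans hω2
  rw [le_div_iff₀ (by positivity)]
  rcases hx.eq_or_lt with h0 | h0
  · rw [← h0, zero_mul]
    exact hA
  · exact le_of_mul_le_mul_right (by nlinarith) h0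

theorem buoyancy_nonneg (M : Model D) : 0 ≤ buoyancy M := by
  have := M.rho_pos
  have := M.beta_pos
  unfold buoyancy
  positivity

theorem refTempNorm_nonneg (M : Model D) : 0 ≤ refTempNorm M := by
  unfold refTempNorm
  positivity

theorem abs_buoyancy_inner_le (f : L2 D) (v : DivPair D) :
    |M.rho * M.beta * inner ℝ f (gravL M (inclL D v.1))| ≤
      buoyancy M * volConst D * ‖f‖ * divNorm v := by
  have hρ := M.rho_pos
  have hβ := M.beta_pos
  have hv := norm_fst_le_divNorm v
  have hc := volConst_nonneg D
  rw [abs_mul, abs_of_pos (by positivity)]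
  calc _ ≤ M.rho * M.beta * (‖f‖ * (‖M.gravity‖ * (volConst D * ‖v.1‖))) := by
        gcongr
        refine (abs_real_inner_le_norm _ _).trans ?_
        gcongr
        refine (norm_gravL_le M _).trans ?_
        gcongr
        exact norm_inclL_le _
    _ ≤ M.rho * M.beta * (‖f‖ * (‖M.gravity‖ * (volConst D * divNorm v))) := by gcongr
    _ = _ := by unfold buoyancy; ring

theorem norm_const_refTemp_le (M : Model D) :
    ‖Lp.const 2 (vol D) M.refTemp‖ ≤ refTempNorm M := by
  refine (Lp.norm_const_le _ _ _).trans (le_of_eq ?_)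
  rw [refTempNorm, measureReal_restrict_apply_univ, Real.sqrt_eq_rpow]
  norm_num

theorem abs_formF_le (T : GradPair D) (v : DivPair D) :
    |formF M T v| ≤ buoyancy M * volConst D * (h1Norm T + refTempNorm M) * divNorm v := by
  rw [formF_eq]
  refine (abs_buoyancy_inner_le _ v).trans ?_
  have h1 := buoyancy_nonneg M
  have h2 := volConst_nonneg D
  have h3 := divNorm_nonneg v
  gcongr
  refine (norm_sub_le _ _).trans ?_
  gcongr
  · exact norm_fst_le_h1Norm T
  · exact norm_const_refTemp_le M

theorem abs_formF_sub_le (T T' : GradPair D) (v : DivPair D) :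
    |formF M T v - formF M T' v| ≤ buoyancy M * volConst D * h1Norm (T - T') * divNorm v := by
  rw [formF_eq, formF_eq, ← mul_sub, ← inner_sub_left, sub_sub_sub_cancel_right]
  refine (abs_buoyancy_inner_le _ v).trans ?_
  have h1 := buoyancy_nonneg M
  have h2 := volConst_nonneg D
  have h3 := divNorm_nonneg v
  gcongr
  exact norm_fst_le_h1Norm (T - T')

theorem existsUnique_solvesReduced {β₁ : ℝ} (hβ : 0 < β₁) (hB1 : InfSupB1 M H β₁)
    (T : GradPair D) : ∃! w, SolvesReduced M H T w := by
  have := H.Z_fin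
  have := H.V_fin
  have hKV : kerVSubmodule H ≤ H.V := fun v hv => hv.1
  have : FiniteDimensional ℝ (kerVSubmodule H) := Submodule.finiteDimensional_of_le hKV
  let B : (H.Z × kerVSubmodule H) →ₗ[ℝ] (H.Z × kerVSubmodule H) →ₗ[ℝ] ℝ := LinearMap.mk₂ ℝ
    (fun w z => a1 w.1.1 z.1.1 + b1 M z.1.1 w.2.1 + (b1 M w.1.1 z.2.1 - a2 M w.2.1 z.2.1))
    (fun w w' z => by
      simp only [a1_eq, b1_eq, a2_eq, Submodule.coe_add, Prod.fst_add, Prod.snd_add, map_add,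
        inner_add_left, add_apply]
      ring)
    (fun c w z => by
      simp only [a1_eq, b1_eq, a2_eq, Submodule.coe_smul, Prod.smul_fst, Prod.smul_snd, map_smul,
        real_inner_smul_left, smul_apply, smul_eq_mul]
      ring)
    (fun w z z' => by
      simp only [a1_eq, b1_eq, a2_eq, Submodule.coe_add, Prod.fst_add, Prod.snd_add, map_add,
        inner_add_right, add_apply]
      ring)
    (fun c w z => by
      simp only [a1_eq, b1_eq, a2_eq, Submodule.coe_smul, Prod.smul_fst, Prod.smul_snd, map_smul,
        real_inner_smul_right, smul_apply, smul_eq_mul]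
      ring)
  let l : (H.Z × kerVSubmodule H) →ₗ[ℝ] ℝ :=
    { toFun := fun z => formF M T z.2.1
      map_add' := fun z z' => by
        simp only [formF_eq, Submodule.coe_add, Prod.fst_add, Prod.snd_add, map_add,
          inner_add_right]
        ring
      map_smul' := fun c z => by
        simp only [formF_eq, Submodule.coe_smul, Prod.smul_fst, Prod.smul_snd, map_smul,
          real_inner_smul_right, smul_eq_mul, RingHom.id_apply]
        ring }
  have hsplit : ∀ (F : DivPair D → ℝ) (_ : F 0 = 0) (w : H.Z × kerVSubmodule H),
      (∀ z, B w z = F z.2.1) ↔ (∀ ζ ∈ H.Z, a1 w.1.1 ζ + b1 M ζ w.2.1 = 0) ∧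
        ∀ v ∈ kerV H, b1 M w.1.1 v - a2 M w.2.1 v = F v := by
    intro F hF0 w
    constructor
    · intro h
      constructor
      · intro ζ hζ
        have e : a1 w.1.1 ζ + b1 M ζ w.2.1 + (b1 M w.1.1 (0 : DivPair D) -
          a2 M w.2.1 (0 : DivPair D)) = F 0 := h (⟨ζ, hζ⟩, 0)
        simpa [b1_eq, a2_eq, hF0] using e
      · intro v hv
        have e : a1 w.1.1 (0 : CurlPair D) + b1 M (0 : CurlPair D) w.2.1 + (b1 M w.1.1 v -
          a2 M w.2.1 v) = F v := h (0, ⟨v, hv⟩)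
        simpa [a1_eq, b1_eq] using e
    · intro h z
      have e1 := h.1 z.1.1 z.1.2
      have e2 := h.2 z.2.1 z.2.2
      change a1 w.1.1 z.1.1 + b1 M z.1.1 w.2.1 + (b1 M w.1.1 z.2.1 - a2 M w.2.1 z.2.1) = _
      rw [e1, e2, zero_add]
  have hB : ∀ w, (∀ z, B w z = 0) → w = 0 := by
    intro w hw
    obtain ⟨h1, h2⟩ := (hsplit (fun _ => 0) rfl w).1 hw
    -- Zero data allow the bound `A = 0`, hence zero velocity and vorticity.
    obtain ⟨h3, h4⟩ := divNorm_le_of_reduced (A := 0) hβ le_rfl hB1 w.1.2 w.2.2 h1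
      (h2 w.2.1 w.2.2) (by simp)
    have h5 : w.1.1.1 = 0 := by
      rw [zero_mul] at h4
      exact norm_eq_zero.1 (pow_eq_zero_iff two_ne_zero |>.1 (le_antisymm h4 (sq_nonneg _)))
    rw [zero_div] at h3
    exact Prod.ext (Subtype.ext (eq_zero_of_mem_HcurlStar (H.Z_conf _ w.1.2) h5))
      (Subtype.ext (eq_zero_of_divNorm_le h3))
  have hl : formF M T (0 : DivPair D) = 0 := by simp [formF_eq]
  obtain ⟨w, hw, huniq⟩ := existsUnique_of_bilinear B hB l
  refine ⟨(w.1.1, w.2.1), ⟨w.1.2, w.2.2, (hsplit (formF M T) hl w).1 hw⟩, fun w' hw' => ?_⟩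
  have := huniq (⟨w'.1, hw'.1⟩, ⟨w'.2, hw'.2.1⟩) ((hsplit (formF M T) hl _).2 hw'.2.2)
  rw [← this]

theorem SolvesReduced.divNorm_le {β₁ : ℝ} (hβ : 0 < β₁) (hB1 : InfSupB1 M H β₁)
    {T : GradPair D} {w : CurlPair D × DivPair D} (hw : SolvesReduced M H T w) :
    divNorm w.2 ≤ volConst D / β₁ ^ 2 * buoyancy M * (h1Norm T + refTempNorm M) := by
  have h1 := buoyancy_nonneg M
  have h2 := volConst_nonneg D
  have h3 := h1Norm_nonneg T
  have h4 := refTempNorm_nonneg M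
  refine (divNorm_le_of_reduced hβ (by positivity) hB1 hw.1 hw.2.1 hw.2.2.1
    (hw.2.2.2 _ hw.2.1) (abs_formF_le T w.2)).1.trans (le_of_eq (by ring))

theorem SolvesReduced.divNorm_sub_le {β₁ : ℝ} (hβ : 0 < β₁) (hB1 : InfSupB1 M H β₁)
    {T T' : GradPair D} {w w' : CurlPair D × DivPair D} (hw : SolvesReduced M H T w)
    (hw' : SolvesReduced M H T' w') :
    divNorm (w.2 - w'.2) ≤ volConst D / β₁ ^ 2 * buoyancy M * h1Norm (T - T') := by
  have h1 := buoyancy_nonneg M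
  have h2 := volConst_nonneg D
  have h3 := h1Norm_nonneg (T - T')
  have hker : w.2 - w'.2 ∈ kerV H := (kerVSubmodule H).sub_mem hw.2.1 hw'.2.1
  refine (divNorm_le_of_reduced (ω := w.1 - w'.1) hβ (by positivity) hB1
    (H.Z.sub_mem hw.1 hw'.1) hker (fun ζ hζ => ?_)
    (F := formF M T (w.2 - w'.2) - formF M T' (w.2 - w'.2)) ?_
    (abs_formF_sub_le T T' _)).1.trans (le_of_eq (by ring))
  · have e1 := hw.2.2.1 ζ hζ
    have e2 := hw'.2.2.1 ζ hζ
    simp only [a1_eq, b1_eq, Prod.fst_sub, map_sub, inner_sub_left] at e1 e2 ⊢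
    linarith
  · rw [← hw.2.2.2 _ hker, ← hw'.2.2.2 _ hker]
    simp only [b1_eq, a2_eq, Prod.fst_sub, Prod.snd_sub, map_sub, inner_sub_left,
      sub_apply]
    ring

/-! ### The Galerkin scheme and the fixed-point map -/

theorem opS1_spec {T : GradPair D} (h : ∃! w, SolvesReduced M H T w) :
    SolvesReduced M H T (opS1 M H T) :=
  Classical.epsilon_spec h.exists

theorem opS2_spec {u : DivPair D} (h : ∃! T, SolvesThermal M H u T) :
    SolvesThermal M H u (opS2 M H u) :=
  Classical.epsilon_spec h.exists

theorem SolvesGalerkin.solvesReduced {X : CurlPair D × DivPair D × L2 D} {T : GradPair D}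
    (h : SolvesGalerkin M H X T) : SolvesReduced M H T (X.1, X.2.1) := by
  obtain ⟨h1, h2, h3, h4, h5, h6, h7, h8⟩ := h
  refine ⟨h1, ⟨h2, h7⟩, h5, fun v hv => ?_⟩
  have := h6 v hv.1
  rwa [hv.2 _ h3, add_zero] at this

theorem SolvesGalerkin.solvesThermal {X : CurlPair D × DivPair D × L2 D} {T : GradPair D}
    (h : SolvesGalerkin M H X T) : SolvesThermal M H X.2.1 T :=
  ⟨h.2.2.2.1, h.2.2.2.2.2.2.2⟩

theorem eq_of_forall_b2_eq {β₂ : ℝ} (hβ : 0 < β₂) (hB2 : InfSupB2 H β₂) {p q : L2 D}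
    (hp : p ∈ H.Q) (hq : q ∈ H.Q) (h : ∀ v ∈ H.V, b2 v p = b2 v q) : p = q := by
  have h1 := hB2 (p - q) (H.Q.sub_mem hp hq)
  have h2 : ⨆ v : {v : DivPair D // v ∈ H.V ∧ v ≠ 0}, b2 v.1 (p - q) / divNorm v.1 ≤ 0 := by
    refine Real.iSup_le (fun v => ?_) le_rfl
    have := h v.1 v.2.1
    rw [b2_eq, b2_eq] at this
    rw [b2_eq, inner_sub_right, this, sub_self, zero_div]
  have h3 : ‖p - q‖ ≤ 0 := by
    by_contra hne
    push Not at hne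
    have := mul_pos hβ hne
    linarith
  exact sub_eq_zero.1 (norm_le_zero_iff.1 h3)

/-- A functional on the discrete velocities that vanishes on the kernel of `b₂` is represented by
a discrete pressure. -/
theorem exists_pressure (l : H.V →ₗ[ℝ] ℝ) (hl : ∀ v : H.V, v.1 ∈ kerV H → l v = 0) :
    ∃ p ∈ H.Q, ∀ v : H.V, b2 v.1 p = l v := by
  have := H.V_fin
  have := H.Q_fin
  let f : H.V →ₗ[ℝ] Module.Dual ℝ H.Q := LinearMap.mk₂ ℝ (fun v q => b2 v.1 q.1)
    (fun v v' q => by simp [b2_eq, inner_add_left])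
    (fun c v q => by simp [b2_eq, real_inner_smul_left])
    (fun v q q' => by simp [b2_eq, inner_add_right])
    (fun c v q => by simp [b2_eq, real_inner_smul_right])
  have hmem : l ∈ f.ker.dualAnnihilator := by
    rw [Submodule.mem_dualAnnihilator]
    intro v hv
    refine hl v ⟨v.2, fun q hq => ?_⟩
    exact LinearMap.congr_fun (LinearMap.mem_ker.1 hv) (⟨q, hq⟩ : H.Q)
  rw [← LinearMap.range_dualMap_eq_dualAnnihilator_ker] at hmem
  obtain ⟨Φ, hΦ⟩ := hmem
  obtain ⟨p, rfl⟩ := (Module.evalEquiv ℝ H.Q).surjective Φ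
  exact ⟨p.1, p.2, fun v => LinearMap.congr_fun hΦ v⟩

theorem existsUnique_solvesGalerkin {β₁ β₂ : ℝ} (hβ₁ : 0 < β₁) (hB1 : InfSupB1 M H β₁)
    (hβ₂ : 0 < β₂) (hB2 : InfSupB2 H β₂) {T : GradPair D} {w : CurlPair D × DivPair D}
    (hw : SolvesReduced M H T w) (hT : SolvesThermal M H w.2 T) :
    ∃! X, SolvesGalerkin M H X T := by
  let l : H.V →ₗ[ℝ] ℝ :=
    { toFun := fun v => formF M T v.1 - (b1 M w.1 v.1 - a2 M w.2 v.1)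
      map_add' := fun v v' => by
        simp only [formF_eq, b1_eq, a2_eq, Submodule.coe_add, Prod.fst_add, map_add,
          inner_add_right]
        ring
      map_smul' := fun c v => by
        simp only [formF_eq, b1_eq, a2_eq, Submodule.coe_smul, Prod.smul_fst, map_smul,
          real_inner_smul_right, smul_eq_mul, RingHom.id_apply]
        ring }
  obtain ⟨p, hp, hpl⟩ := exists_pressure l fun v hv => sub_eq_zero.2 (hw.2.2.2 v.1 hv).symm
  have hsol : SolvesGalerkin M H (w.1, w.2, p) T := by
    refine ⟨hw.1, hw.2.1.1, hp, hT.1, hw.2.2.1, fun v hv => ?_, hw.2.1.2, hT.2⟩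
    have : b2 v p = formF M T v - (b1 M w.1 v - a2 M w.2 v) := hpl ⟨v, hv⟩
    change b1 M w.1 v - a2 M w.2 v + b2 v p = _
    rw [this]
    ring
  refine ⟨_, hsol, fun X hX => ?_⟩
  have hXw : (X.1, X.2.1) = w :=
    (existsUnique_solvesReduced hβ₁ hB1 T).unique hX.solvesReduced hw
  obtain ⟨ω, u, q⟩ := X
  simp only at hXw
  subst hXw
  have hpq : q = p := by
    refine eq_of_forall_b2_eq hβ₂ hB2 hX.2.2.1 hp fun v hv => ?_
    have e1 := hX.2.2.2.2.2.1 v hv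
    have e2 := hsol.2.2.2.2.2.1 v hv
    simp only at e1 e2
    linarith
  rw [hpq]

theorem mapF_eq_iff (hd : d ≤ 3) {β₁ β₂ : ℝ} (hβ₁ : 0 < β₁) (hB1 : InfSupB1 M H β₁)
    (hβ₂ : 0 < β₂) (hB2 : InfSupB2 H β₂) (hH : DivCompatible H) (T : GradPair D) :
    mapF M H T = T ↔ ∃! X, SolvesGalerkin M H X T := by
  have hw := opS1_spec (existsUnique_solvesReduced hβ₁ hB1 T)
  constructor
  · intro h
    have hT := opS2_spec (existsUnique_solvesThermal (M := M) hd hH hw.2.1)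
    rw [mapF] at h
    rw [h] at hT
    exact existsUnique_solvesGalerkin hβ₁ hB1 hβ₂ hB2 hw hT
  · rintro ⟨X, hX, -⟩
    have e : opS1 M H T = (X.1, X.2.1) :=
      (existsUnique_solvesReduced hβ₁ hB1 T).unique hw hX.solvesReduced
    have hu : X.2.1 ∈ kerV H := hX.solvesReduced.2.1
    have hex := existsUnique_solvesThermal (M := M) hd hH hu
    rw [mapF, e]
    exact hex.unique (opS2_spec hex) hX.solvesThermal

/-- The contraction principle for the norm of `H¹` in a finite-dimensional space. -/
theorem existsUnique_fixedPoint {Y : Submodule ℝ (GradPair D)} [FiniteDimensional ℝ Y] {R K : ℝ}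
    (hR : 0 ≤ R) (hK0 : 0 ≤ K) (hK : K < 1) {f : GradPair D → GradPair D}
    (hmap : ∀ T ∈ Y, h1Norm T ≤ R → f T ∈ Y ∧ h1Norm (f T) ≤ R)
    (hlip : ∀ T ∈ Y, ∀ T' ∈ Y, h1Norm T ≤ R → h1Norm T' ≤ R →
      h1Norm (f T - f T') ≤ K * h1Norm (T - T')) :
    ∃! T, (T ∈ Y ∧ h1Norm T ≤ R) ∧ f T = T := by
  let s : Set (WithLp 2 (GradPair D)) := {x | WithLp.ofLp x ∈ Y ∧ ‖x‖ ≤ R}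
  have hs : IsClosed s := by
    refine IsClosed.inter ?_ (isClosed_le continuous_norm continuous_const)
    exact (Submodule.closed_of_finiteDimensional Y).preimage (WithLp.prod_continuous_ofLp 2 _ _)
  let F : WithLp 2 (GradPair D) → WithLp 2 (GradPair D) := fun x =>
    WithLp.toLp 2 (f (WithLp.ofLp x))
  have hnorm : ∀ x : WithLp 2 (GradPair D), h1Norm (WithLp.ofLp x) = ‖x‖ := fun x =>
    h1Norm_eq_norm _
  have hF : Set.MapsTo F s s := fun x hx => by
    obtain ⟨h1, h2⟩ := hmap _ hx.1 (by rw [hnorm]; exact hx.2)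
    exact ⟨h1, by rwa [h1Norm_eq_norm] at h2⟩
  have hcontr : ContractingWith ⟨K, hK0⟩ (hF.restrict F s s) := by
    refine ⟨hK, LipschitzWith.of_dist_le_mul fun x y => ?_⟩
    have h := hlip _ x.2.1 _ y.2.1 (by rw [hnorm]; exact x.2.2) (by rw [hnorm]; exact y.2.2)
    rw [h1Norm_eq_norm, h1Norm_eq_norm] at h
    rw [Subtype.dist_eq, Subtype.dist_eq, dist_eq_norm, dist_eq_norm]
    exact h
  have h0 : (0 : WithLp 2 (GradPair D)) ∈ s := ⟨Y.zero_mem, by simpa using hR⟩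
  obtain ⟨y, hy, hfix, -⟩ := hcontr.exists_fixedPoint' hs.isComplete hF h0 (edist_ne_top _ _)
  refine ⟨WithLp.ofLp y, ⟨⟨hy.1, by rw [hnorm]; exact hy.2⟩, congrArg WithLp.ofLp hfix⟩, ?_⟩
  rintro T ⟨⟨hT, hTR⟩, hTf⟩
  have h := hlip T hT _ hy.1 hTR (by rw [hnorm]; exact hy.2)
  have hfy : f (WithLp.ofLp y) = WithLp.ofLp y := congrArg WithLp.ofLp hfix
  rw [hTf, hfy] at h
  have hn := h1Norm_nonneg (T - WithLp.ofLp y)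
  have hz : h1Norm (T - WithLp.ofLp y) = 0 := by nlinarith
  rw [h1Norm_eq_norm, norm_eq_zero] at hz
  exact sub_eq_zero.1 (congrArg WithLp.ofLp hz)

end Reduced

/-! ### Contraction of the fixed-point map -/

section Main
variable {d : ℕ} {D : MixedDomain d} {M : Model D} {H : DiscreteSpaces D}

/-- The interval between the roots is the set where `C₁ - R + C₂ R² ≤ 0`. -/
theorem quadratic_le_of_root_le {c₁ c₂ R : ℝ} (h1 : 0 ≤ c₁) (h2 : 0 < c₂) (h : c₁ * c₂ < 1 / 4)
    (hl : (1 - √(1 - 4 * c₁ * c₂)) / (2 * c₂) ≤ R) (hr : R ≤ (1 + √(1 - 4 * c₁ * c₂)) / (2 * c₂)) :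
    c₁ + c₂ * R ^ 2 ≤ R ∧ c₂ * R ≤ 1 := by
  set s := √(1 - 4 * c₁ * c₂) with hs
  have hs0 : 0 ≤ s := Real.sqrt_nonneg _
  have hs2 : s ^ 2 = 1 - 4 * c₁ * c₂ := Real.sq_sqrt (by linarith)
  have hs1 : s ≤ 1 := by
    have := mul_nonneg h1 h2.le
    nlinarith
  rw [div_le_iff₀ (by positivity)] at hl
  rw [le_div_iff₀ (by positivity)] at hr
  refine ⟨?_, by linarith⟩
  have hsq : (2 * c₂ * R - 1) ^ 2 ≤ s ^ 2 := by
    rw [sq_le_sq, abs_of_nonneg hs0]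
    exact abs_le.2 ⟨by linarith, by linarith⟩
  have : c₂ * (c₁ + c₂ * R ^ 2) ≤ c₂ * R := by nlinarith
  exact le_of_mul_le_mul_left this h2

/-- Unique fixed point in the ball of radius `R`. With the thermal stability constant multiplied
by four, the bounds `C₂ R ≤ 1` and `C₂ ‖T₀‖ ≤ 1 / 2`, which follow from the smallness condition,
control the part of the Lipschitz constant that comes from the quadratic source. -/
theorem existsUnique_mapF (hd : d ≤ 3) {β₁ : ℝ} (hβ₁ : 0 < β₁) (hB1 : InfSupB1 M H β₁)
    (hH : DivCompatible H) {cs1 cs2 : ℝ} (hcs1 : cs1 = volConst D / β₁ ^ 2)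
    (hcs2 : cs2 = 4 * thermalConst D.Ω) {R : ℝ} (hR : 0 < R)
    (hsmall : const1 M cs1 cs2 * const2 M cs1 cs2 < 1 / 4)
    (hl : root1 M cs1 cs2 ≤ R) (hr : R ≤ root2 M cs1 cs2)
    (hcon : R * cs1 * cs2 * buoyancy M * invCoer M * (1 + 2 * cs1 * buoyancy M) < 1) :
    ∃! T, (T ∈ H.Y ∧ h1Norm T ≤ R) ∧ mapF M H T = T := by
  have := H.Y_fin
  have hB := buoyancy_nonneg M
  have ht := refTempNorm_nonneg M
  have hm := invCoer_pos M
  have hν := nu_pos M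
  have hC := one_le_thermalConst D.Ω
  have hcs1' : 0 ≤ cs1 := by
    have := volConst_nonneg D
    rw [hcs1]; positivity
  have hw : ∀ T, SolvesReduced M H T (opS1 M H T) := fun T =>
    opS1_spec (existsUnique_solvesReduced hβ₁ hB1 T)
  have hth : ∀ T, SolvesThermal M H (opS1 M H T).2 (mapF M H T) := fun T =>
    opS2_spec (existsUnique_solvesThermal hd hH (hw T).2.1)
  have hu : ∀ T, divNorm (opS1 M H T).2 ≤ cs1 * buoyancy M * (h1Norm T + refTempNorm M) :=
    fun T => by rw [hcs1]; exact (hw T).divNorm_le hβ₁ hB1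
  have hulip : ∀ T T', divNorm ((opS1 M H T).2 - (opS1 M H T').2) ≤
      cs1 * buoyancy M * h1Norm (T - T') :=
    fun T T' => by rw [hcs1]; exact (hw T).divNorm_sub_le hβ₁ hB1 (hw T')
  set c₁ := const1 M cs1 cs2 with hc₁
  set c₂ := const2 M cs1 cs2 with hc₂
  have e₁ : c₁ = cs2 * invCoer M * (‖M.source‖ + M.mu / (M.heatCap * M.rho * M.kappa) *
    (cs1 * buoyancy M * refTempNorm M) ^ 2) := rfl
  have e₂ : c₂ = cs1 ^ 2 * cs2 * invCoer M * buoyancy M ^ 2 *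
    (M.mu / (M.heatCap * M.rho * M.kappa)) := rfl
  set ν := M.mu / (M.heatCap * M.rho * M.kappa) with hνdef
  set B := buoyancy M
  set m := invCoer M
  set t := refTempNorm M
  set C := thermalConst D.Ω
  have hg := norm_nonneg M.source
  have hcs2' : 0 < cs2 := by rw [hcs2]; positivity
  have hc₁0 : 0 ≤ c₁ := by rw [e₁]; positivity
  have hc₂0 : 0 < c₂ := by
    have h0 : 0 ≤ c₂ := by rw [e₂]; positivity
    refine h0.lt_of_ne fun h => ?_
    -- With `C₂ = 0` the roots have the value zero.
    have hz : root2 M cs1 cs2 = 0 := by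
      unfold root2
      rw [← hc₂, ← h]
      simp
    linarith
  obtain ⟨hquad, hcR⟩ := quadratic_le_of_root_le hc₁0 hc₂0 hsmall hl hr
  have hct : c₂ * t ≤ 1 / 2 := by
    have h1 : (c₂ * t) ^ 2 ≤ c₁ * c₂ := by
      have : c₁ * c₂ = cs2 * m * ‖M.source‖ * c₂ + (c₂ * t) ^ 2 := by rw [e₁, e₂]; ring
      have h0 : 0 ≤ cs2 * m * ‖M.source‖ * c₂ := by positivity
      linarith
    by_contra hcon'
    push Not at hcon'
    nlinarith
  have h4 : R * cs1 * cs2 * B * m < 1 := by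
    refine lt_of_le_of_lt (le_mul_of_one_le_right (by positivity) ?_) hcon
    have : 0 ≤ 2 * cs1 * B := by positivity
    linarith
  have hself : ∀ T, h1Norm T ≤ R → h1Norm (mapF M H T) ≤ R := by
    intro T hT
    refine ((hth T).h1Norm_le hd hH (hw T).2.1).trans (le_trans ?_ hquad)
    have h5 : divNorm (opS1 M H T).2 ^ 2 ≤ (cs1 * B * (R + t)) ^ 2 := by
      refine pow_le_pow_left₀ (divNorm_nonneg _) ((hu T).trans ?_) 2
      gcongr
    -- The factor four in `cs2` absorbs the mixed term of the square.
    have h6 : (cs1 * B * (R + t)) ^ 2 ≤ 4 * ((cs1 * B) ^ 2 * R ^ 2 + (cs1 * B * t) ^ 2) := by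
      nlinarith [sq_nonneg (cs1 * B * (R - t)), sq_nonneg (cs1 * B * R), sq_nonneg (cs1 * B * t)]
    calc C * m * (‖M.source‖ + ν * divNorm (opS1 M H T).2 ^ 2)
        ≤ C * m * (4 * ‖M.source‖ +
          ν * (4 * ((cs1 * B) ^ 2 * R ^ 2 + (cs1 * B * t) ^ 2))) := by
          gcongr
          · linarith
          · exact h5.trans h6
      _ = c₁ + c₂ * R ^ 2 := by rw [e₁, e₂, hcs2]; ring
  set K := C * m * (cs1 * B) * (R + ν * (2 * (cs1 * B * (R + t)))) with hK
  have hK0 : 0 ≤ K := by positivity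
  have hK1 : K < 1 := by
    have : 4 * K = R * cs1 * cs2 * B * m + 2 * (c₂ * R) + 2 * (c₂ * t) := by
      rw [hK, e₂, hcs2]; ring
    linarith
  refine existsUnique_fixedPoint hR.le hK0 hK1 (fun T _ hT => ⟨(hth T).1, hself T hT⟩)
    fun T _ T' _ hT hT' => ?_
  refine ((hth T).h1Norm_sub_le hd hH (hw T).2.1 (hth T')).trans ?_
  have h7 := h1Norm_nonneg (T - T')
  have h8 := h1Norm_nonneg (mapF M H T')
  have hub : ∀ T, h1Norm T ≤ R → divNorm (opS1 M H T).2 ≤ cs1 * B * (R + t) := fun T hT =>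
    (hu T).trans (by gcongr)
  have h9 := divNorm_nonneg (opS1 M H T).2
  have h10 := divNorm_nonneg (opS1 M H T').2
  calc C * m * divNorm ((opS1 M H T).2 - (opS1 M H T').2) *
        (h1Norm (mapF M H T') + ν * (divNorm (opS1 M H T).2 + divNorm (opS1 M H T').2))
      ≤ C * m * (cs1 * B * h1Norm (T - T')) *
        (R + ν * (cs1 * B * (R + t) + cs1 * B * (R + t))) := by
        gcongr
        · exact hulip T T'
        · exact hself T' hT'
        · exact hub T hT
        · exact hub T' hT'
    _ = K * h1Norm (T - T') := by rw [hK]; ring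

end Main

end DarcyBrinkman

theorem mainTheorem5 (d : ℕ) (hd : d = 2 ∨ d = 3) :
    ∃ (C₁ : ℝ → ℝ → ℝ) (C₂ : Set (Pt d) → ℝ),
      (∀ a b : ℝ, 0 < a → 0 < b → 0 < C₁ a b) ∧ (∀ Ω : Set (Pt d), 0 < C₂ Ω) ∧
      ∀ (D : MixedDomain d) (M : Model D) (H : DiscreteSpaces D) (β₁ β₂ cs1 cs2 : ℝ),
        0 < β₁ → 0 < β₂ → InfSupB1 M H β₁ → InfSupB2 H β₂ → DivCompatible H →
        cs1 = C₁ (volConst D) β₁ → cs2 = C₂ D.Ω →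
        -- the solution operators composing the discrete fixed-point map are well defined and
        -- stable, with constants `cs1`, `cs2`
        (∀ T ∈ H.Y, (∃! w, SolvesReduced M H T w) ∧
          divNorm (opS1 M H T).2 ≤ cs1 * buoyancy M * (h1Norm T + refTempNorm M)) ∧
        (∀ u ∈ kerV H, (∃! T, SolvesThermal M H u T) ∧
          h1Norm (opS2 M H u) ≤ cs2 * invCoer M *
            (‖M.source‖ + M.mu / (M.heatCap * M.rho * M.kappa) * divNorm u ^ 2)) ∧
        -- fixed points are the temperatures of the solutions of the Galerkin scheme
        (∀ T ∈ H.Y, mapF M H T = T ↔ ∃! X, SolvesGalerkin M H X T) ∧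
        -- unique solvability in the ball
        ∀ R : ℝ, 0 < R →
          const1 M cs1 cs2 * const2 M cs1 cs2 < 1 / 4 →
          root1 M cs1 cs2 ≤ R → R ≤ root2 M cs1 cs2 →
          R * cs1 * cs2 * buoyancy M * invCoer M * (1 + 2 * cs1 * buoyancy M) < 1 →
          (∃! T, (T ∈ H.Y ∧ h1Norm T ≤ R) ∧ mapF M H T = T) ∧
          (∃! XT : (CurlPair D × DivPair D × L2 D) × GradPair D,
            SolvesGalerkin M H XT.1 XT.2 ∧ h1Norm XT.2 ≤ R) := by
  have hd3 : d ≤ 3 := by rcases hd with rfl | rfl <;> norm_num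
  refine ⟨fun a b => a / b ^ 2, fun Ω => 4 * thermalConst Ω, fun a b ha hb => by positivity,
    fun Ω => ?_, ?_⟩
  · have := one_le_thermalConst Ω
    positivity
  intro D M H β₁ β₂ cs1 cs2 hβ₁ hβ₂ hB1 hB2 hH hcs1 hcs2
  have hred : ∀ T, ∃! w, SolvesReduced M H T w := existsUnique_solvesReduced hβ₁ hB1
  refine ⟨fun T _ => ⟨hred T, ?_⟩, fun u hu => ?_,
    fun T _ => mapF_eq_iff hd3 hβ₁ hB1 hβ₂ hB2 hH T, ?_⟩
  · rw [hcs1]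
    exact (opS1_spec (hred T)).divNorm_le hβ₁ hB1
  · have hex := existsUnique_solvesThermal (M := M) hd3 hH hu
    refine ⟨hex, ((opS2_spec hex).h1Norm_le hd3 hH hu).trans ?_⟩
    have hm := invCoer_pos M
    have hν := nu_pos M
    have hC := one_le_thermalConst D.Ω
    rw [hcs2]
    gcongr
    linarith
  · intro R hR hsmall hl hr hcon
    have hfix := existsUnique_mapF hd3 hβ₁ hB1 hH hcs1 hcs2 hR hsmall hl hr hcon
    refine ⟨hfix, ?_⟩
    obtain ⟨T, ⟨⟨hTY, hTR⟩, hT⟩, huniq⟩ := hfix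
    obtain ⟨X, hX, hXuniq⟩ := (mapF_eq_iff hd3 hβ₁ hB1 hβ₂ hB2 hH T).1 hT
    refine ⟨(X, T), ⟨hX, hTR⟩, ?_⟩
    rintro ⟨X', T'⟩ ⟨hX', hTR'⟩
    have hT' : mapF M H T' = T' := (mapF_eq_iff hd3 hβ₁ hB1 hβ₂ hB2 hH T').2
      (existsUnique_solvesGalerkin hβ₁ hB1 hβ₂ hB2 hX'.solvesReduced hX'.solvesThermal)
    obtain rfl := huniq T' ⟨⟨hX'.solvesThermal.1, hTR'⟩, hT'⟩
    rw [hXuniq X' hX']
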